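/- **Arithmetic Expression Construction (AEC).** Let $\mathbb L$ be a field, $\mathsf{ops}\subseteq\{+,-,\times,\div\}$, and $\mathsf{var}$ one of three variants. An instance consists of a multiset $A=\{a_1,\dots,a_n\}$ of elements of $\mathbb L$, a target $t\in\mathbb L$ and additional data $D$. It is *solvable* if there is a binary expression tree whose internal nodes carry operations from $\mathsf{ops}$, whose leaves carry each element of $A$ exactly once (with multiplicity), which satisfies the constraint of the variant, and which evaluates to $t$ without any division by zero. Constraints: none (Standard; no $D$); the leaves from left to right are in the order prescribed by $D$ (Enforced Leaves); the tree with its leaves emptied is the given tree $D$, whose operations belong to $\mathsf{ops}$ (Enforced Operations). For $\mathbb L=\mathbb Q(x_1,\dots,x_k)$ the values and the target are given as quotients $f/g$ of polynomials $f,g\in\mathbb Z[x_1,\dots,x_k]$ with $g\ne 0$, not necessarily in lowest terms; a polynomial is presented by the list of its nonzero terms, with integer coefficients in binary and exponents in unary. For $a=f/g$ so given, let $\deg a=\max(\deg f,\deg g)$ (total degrees, $\deg 0=0$), $m(a)=\binom{\deg a+k}{\deg a}$, and let $\mathrm{maxcoeff}(a)$ be the largest absolute value of a coefficient of $f$ or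 $g$. *Substituting* $x_k=B$ replaces each $f/g$ by $f(x_1,\dots,x_{k-1},B)/g(x_1,\dots,x_{k-1},B)$ and leaves $D$ unchanged. **Theorem (Rational Function Framework).** For every $\mathsf{ops}\subseteq\{+,-,\times,\div\}$, every variant (Standard, Enforced Operations, Enforced Leaves) and every integer $k>0$ there is a polynomial-time algorithm $\mathcal A$ mapping each instance $I$ over $\mathbb Q(x_1,\dots,x_k)$ to a positive integer $\mathcal A(I)$ (written in binary) such that substituting $x_k=B$ for any integer $B\ge\mathcal A(I)$ is a polynomial-time reduction from AEC over $\mathbb Q(x_1,\dots,x_k)$ to AEC over $\mathbb Q(x_1,\dots,x_{k-1})$, for the same $\mathsf{ops}$ and variant. That is: 1. for every $I$ and every integer $B\ge\mathcal A(I)$, no denominator of $I$ vanishes under $x_k=B$, and $I$ is solvable if and only if the instance obtained by substituting $x_k=B$ is solvable; 2. the substitution is computable in time polynomial in the length of $I$ and of the binary notation of $B$; in particular, for every polynomial-time computable function $I\mapsto B(I)$ with $B(I)\ge\mathcal A(I)$, the map which substitutes $x_k=B(I)$ in $I$ is a polynomial-time many-one reduction. One may take $\mathcal A(I)=2\,m(t)\,\mathrm{maxcoeff}(t)\,(2Mq)^n$,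 where $n=|A|$, $M=\sum_{a\in A}m(a)$ and $q=\max_{a\in A}\mathrm{maxcoeff}(a)$ (with $M=q=0$ and $0^0=1$ if $n=0$). -/

import Mathlib

namespace AEC

/-! ### Polynomial time

The machine model is a first-order WHILE language whose values are finite binary trees.  Every rule
of the evaluation charges `1 + (size of the value it is applied to)`, so that copying a value is paid
for, a value is never larger than the cost of producing it, and the total cost is polynomially
related to the running time of a Turing machine (in both directions). -/

/-- The values of the model: finite binary trees with one kind of leaf. -/
inductive Data : Type
  | nil : Data
  | cons : Data → Data → Data

namespace Data

/-- The number of nodes of a tree. -/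
def size : Data → ℕ
  | nil => 1
  | cons a b => a.size + b.size + 1

/-- First component (`nil` has none, and gives `nil`). -/
def head : Data → Data
  | nil => nil
  | cons a _ => a

/-- Second component (`nil` has none, and gives `nil`). -/
def tail : Data → Data
  | nil => nil
  | cons _ b => b

/-- A list of trees, as a right comb. -/
def ofList : List Data → Data
  | [] => nil
  | a :: l => cons a (ofList l)

/-- A truth value. -/
def ofBool : Bool → Data
  | false => nil
  | true => cons nil nil

/-- A natural number in binary, least significant bit first, without leading zeros. -/
def ofNat (n : ℕ) : Data := ofList (n.bits.map ofBool)

/-- An integer: whether it is negative, and its absolute value in binary. -/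
def ofInt (z : ℤ) : Data := cons (ofBool (decide (z < 0))) (ofNat z.natAbs)

/-- A natural number in unary. -/
def ofUnary (n : ℕ) : Data := ofList (List.replicate n nil)

end Data

/-- Programs; each maps a tree to a tree. -/
inductive Prog : Type
  /-- the constant `nil` -/
  | nil : Prog
  /-- the identity -/
  | id : Prog
  /-- first component -/
  | head : Prog
  /-- second component -/
  | tail : Prog
  /-- run both programs on the input and pair their results -/
  | pair : Prog → Prog → Prog
  /-- run the first program, then run the second one on its result -/
  | seq : Prog → Prog → Prog
  /-- if the first program returns something other than `nil`, run the second one on the input,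
  otherwise run the third one on the input -/
  | cond : Prog → Prog → Prog → Prog
  /-- as long as the first program does not return `nil` on the current value, replace the current
  value by the result of the second program on it -/
  | loop : Prog → Prog → Prog

/-- `Runs p x y c`: on input `x` the program `p` stops with output `y`, at cost `c`. -/
inductive Runs : Prog → Data → Data → ℕ → Prop
  | nil (x : Data) : Runs Prog.nil x Data.nil (x.size + 1)
  | id (x : Data) : Runs Prog.id x x (x.size + 1)
  | head (x : Data) : Runs Prog.head x x.head (x.size + 1)
  | tail (x : Data) : Runs Prog.tail x x.tail (x.size + 1)
  | pair {p q : Prog} {x y z : Data} {m n : ℕ} :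
      Runs p x y m → Runs q x z n → Runs (Prog.pair p q) x (Data.cons y z) (m + n + (x.size + 1))
  | seq {p q : Prog} {x y z : Data} {m n : ℕ} :
      Runs p x y m → Runs q y z n → Runs (Prog.seq p q) x z (m + n + (x.size + 1))
  | cond_true {c p q : Prog} {x v y : Data} {m n : ℕ} :
      Runs c x v m → v ≠ Data.nil → Runs p x y n →
        Runs (Prog.cond c p q) x y (m + n + (x.size + 1))
  | cond_false {c p q : Prog} {x y : Data} {m n : ℕ} :
      Runs c x Data.nil m → Runs q x y n → Runs (Prog.cond c p q) x y (m + n + (x.size + 1))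
  | loop_stop {c p : Prog} {x : Data} {m : ℕ} :
      Runs c x Data.nil m → Runs (Prog.loop c p) x x (m + (x.size + 1))
  | loop_step {c p : Prog} {x v y z : Data} {m n r : ℕ} :
      Runs c x v m → v ≠ Data.nil → Runs p x y n → Runs (Prog.loop c p) y z r →
        Runs (Prog.loop c p) x z (m + n + r + (x.size + 1))

/-- `f` is computable in polynomial time, where `ρ a d` (resp. `σ b d`) says that the tree `d` is a
presentation of the object `a` (resp. `b`).  An object may have several presentations (for instance,
the terms of a polynomial can be listed in any order): the program has to work on each presentation
of the argument, and has to return some presentation of the value, at a cost which is polynomial in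
the size of the presentation of the argument. -/
def PolyTime {α β : Type} (ρ : α → Data → Prop) (σ : β → Data → Prop) (f : α → β) : Prop :=
  ∃ (p : Prog) (T : Polynomial ℕ), ∀ (a : α) (d : Data), ρ a d →
    ∃ (d' : Data) (c : ℕ), Runs p d d' c ∧ c ≤ T.eval d.size ∧ σ (f a) d'

/-- Presentation of natural numbers: binary notation. -/
def NatRep (n : ℕ) (d : Data) : Prop := d = Data.ofNat n

/-- Presentation of ordered pairs. -/
def ProdRep {α β : Type} (ρ : α → Data → Prop) (σ : β → Data → Prop) (x : α × β) (d : Data) :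
    Prop :=
  ∃ d₁ d₂, ρ x.1 d₁ ∧ σ x.2 d₂ ∧ d = Data.cons d₁ d₂

/-- Presentation of finite lists. -/
def ListRep {α : Type} (ρ : α → Data → Prop) (l : List α) (d : Data) : Prop :=
  ∃ ds, List.Forall₂ ρ l ds ∧ d = Data.ofList ds

/-- `f` is a polynomial-time many-one reduction from the decision problem `P` to `Q`. -/
def IsPolyTimeReduction {α β : Type} (ρ : α → Data → Prop) (σ : β → Data → Prop)
    (P : α → Prop) (Q : β → Prop) (f : α → β) : Prop :=
  PolyTime ρ σ f ∧ ∀ a, P a ↔ Q (f a)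

/-! ### Arithmetic Expression Construction -/

/-- The four arithmetic operations. -/
inductive Op : Type
  | add | sub | mul | div

/-- The three variants: Standard, Enforced Operations, Enforced Leaves. -/
inductive Variant : Type
  | std | eo | el

/-- Expression trees with leaves labelled by `V`. -/
inductive ExprTree (V : Type) : Type
  | leaf : V → ExprTree V
  | node : Op → ExprTree V → ExprTree V → ExprTree V

namespace ExprTree

variable {V : Type}

/-- The leaves from left to right. -/
def leaves : ExprTree V → List V
  | leaf a => [a]
  | node _ l r => l.leaves ++ r.leaves

/-- The expression tree with its leaves emptied. -/
def shape : ExprTree V → ExprTree Unit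
  | leaf _ => leaf ()
  | node o l r => node o l.shape r.shape

/-- All operations at internal nodes belong to `ops`. -/
def OpsIn (ops : Set Op) : ExprTree V → Prop
  | leaf _ => True
  | node o l r => o ∈ ops ∧ l.OpsIn ops ∧ r.OpsIn ops

/-- `E.Evaluates v`: the expression `E` is defined and has the value `v`.  An expression which
divides by zero somewhere has no value. -/
inductive Evaluates {L : Type} [Field L] : ExprTree L → L → Prop
  | leaf (a : L) : Evaluates (leaf a) a
  | add {l r : ExprTree L} {x y : L} :
      Evaluates l x → Evaluates r y → Evaluates (node Op.add l r) (x + y)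
  | sub {l r : ExprTree L} {x y : L} :
      Evaluates l x → Evaluates r y → Evaluates (node Op.sub l r) (x - y)
  | mul {l r : ExprTree L} {x y : L} :
      Evaluates l x → Evaluates r y → Evaluates (node Op.mul l r) (x * y)
  | div {l r : ExprTree L} {x y : L} :
      Evaluates l x → Evaluates r y → y ≠ 0 → Evaluates (node Op.div l r) (x / y)

end ExprTree

/-- The additional data of an instance, apart from its values and its target.  Enforced Operations
has an expression tree with operations from `ops` and empty leaves.  The leaf order of Enforced
Leaves is the order in which the values are listed, so nothing else is needed there. -/
def Extra (ops : Set Op) : Variant → Type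
  | Variant.std => Unit
  | Variant.el => Unit
  | Variant.eo => {D : ExprTree Unit // D.OpsIn ops}

/-- Instances with values of type `V`.  The list `values` is the multiset of values (only for
Enforced Leaves its order matters). -/
structure Instance (ops : Set Op) (var : Variant) (V : Type) : Type where
  /-- the values, listed with multiplicity -/
  values : List V
  /-- the target -/
  target : V
  /-- the constraint on the expression tree -/
  extra : Extra ops var

/-- The expression trees that an instance allows, as far as its target is not concerned: they use
each value exactly once, have operations from `ops`, and satisfy the constraint of the variant. -/
def Allowed (ops : Set Op) {V : Type} (vals : List V) (E : ExprTree V) :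
    (var : Variant) → Extra ops var → Prop
  | Variant.std, _ => E.OpsIn ops ∧ E.leaves.Perm vals
  | Variant.el, _ => E.OpsIn ops ∧ E.leaves = vals
  | Variant.eo, D => E.shape = D.val ∧ E.leaves.Perm vals

namespace Instance

variable {ops : Set Op} {var : Variant}

/-- Apply a map to the values and to the target. -/
def map {V W : Type} (φ : V → W) (I : Instance ops var V) : Instance ops var W where
  values := I.values.map φ
  target := φ I.target
  extra := I.extra

/-- An instance over a field is solvable if some allowed expression evaluates to the target. -/
def Solvable {L : Type} [Field L] (I : Instance ops var L) : Prop :=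
  ∃ E : ExprTree L, Allowed ops I.values E var I.extra ∧ E.Evaluates I.target

end Instance

/-! ### Rational functions, as quotients of polynomials with integer coefficients -/

/-- The field `ℚ(x₁, …, x_k)`. -/
abbrev RatFun (k : ℕ) : Type := FractionRing (MvPolynomial (Fin k) ℚ)

/-- The largest absolute value of a coefficient of `f` (`0` if `f = 0`). -/
def maxcoeff {k : ℕ} (f : MvPolynomial (Fin k) ℤ) : ℕ :=
  f.support.sup fun e => (f.coeff e).natAbs

/-- The polynomial with `B` substituted for the last variable. -/
noncomputable def substPoly {k : ℕ} (B : ℕ) (f : MvPolynomial (Fin (k + 1)) ℤ) :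
    MvPolynomial (Fin k) ℤ :=
  MvPolynomial.aeval
    (Fin.lastCases (motive := fun _ => MvPolynomial (Fin k) ℤ)
      (MvPolynomial.C (B : ℤ)) (fun i => MvPolynomial.X i)) f

/-- A numerator and a denominator. -/
structure Frac (k : ℕ) : Type where
  /-- numerator -/
  num : MvPolynomial (Fin k) ℤ
  /-- denominator -/
  den : MvPolynomial (Fin k) ℤ

namespace Frac

variable {k : ℕ}

/-- The rational function `num / den` (meaningful if `den ≠ 0`). -/
noncomputable def val (a : Frac k) : RatFun k :=
  algebraMap (MvPolynomial (Fin k) ℚ) (RatFun k) (a.num.map (Int.castRingHom ℚ)) /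
    algebraMap (MvPolynomial (Fin k) ℚ) (RatFun k) (a.den.map (Int.castRingHom ℚ))

/-- Substitute `B` for the last variable, in the numerator and in the denominator. -/
noncomputable def subst (B : ℕ) (a : Frac (k + 1)) : Frac k where
  num := substPoly B a.num
  den := substPoly B a.den

/-- The larger one of the total degrees of numerator and denominator. -/
noncomputable def deg (a : Frac k) : ℕ := max a.num.totalDegree a.den.totalDegree

/-- The number of monomials in `k` variables of degree at most `a.deg`. -/
noncomputable def terms (a : Frac k) : ℕ := (a.deg + k).choose a.deg

/-- The largest absolute value of a coefficient of the numerator or of the denominator. -/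
def maxc (a : Frac k) : ℕ := max (maxcoeff a.num) (maxcoeff a.den)

end Frac

/-- The instances of AEC over `ℚ(x₁, …, x_k)`: all values and the target are given as quotients of
polynomials with integer coefficients and with nonzero denominators. -/
structure RatInstance (ops : Set Op) (var : Variant) (k : ℕ) : Type where
  /-- the values, the target and the constraint -/
  inst : Instance ops var (Frac k)
  /-- the denominators of the values are nonzero -/
  values_den : ∀ a ∈ inst.values, a.den ≠ 0
  /-- the denominator of the target is nonzero -/
  target_den : inst.target.den ≠ 0

namespace RatInstance

variable {ops : Set Op} {var : Variant} {k : ℕ}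

/-- Solvability, in the field `ℚ(x₁, …, x_k)`. -/
def Solvable (I : RatInstance ops var k) : Prop := (I.inst.map Frac.val).Solvable

/-- `J` results from `I` by substituting `B` for the last variable.  That `J` is an instance means
that no denominator vanishes under the substitution. -/
def IsSubst (I : RatInstance ops var (k + 1)) (B : ℕ) (J : RatInstance ops var k) : Prop :=
  J.inst = I.inst.map (Frac.subst B)

/-- The explicit bound `2 m(t) maxcoeff(t) (2 M q) ^ n`: here `n` is the number of values, `M` the
sum of the numbers `m(a)` over the values `a`, and `q` the largest absolute value of a coefficient
in the values. -/
noncomputable def bound (I : RatInstance ops var k) : ℕ :=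
  2 * I.inst.target.terms * I.inst.target.maxc *
    (2 * (I.inst.values.map Frac.terms).sum * (I.inst.values.map Frac.maxc).foldr max 0) ^
      I.inst.values.length

end RatInstance

/-! ### Presentation of instances -/

/-- A term `c x^e`: the coefficient in binary, and the list of the exponents in unary. -/
def termData {k : ℕ} (c : ℤ) (e : Fin k →₀ ℕ) : Data :=
  Data.cons (Data.ofInt c) (Data.ofList (List.ofFn fun i => Data.ofUnary (e i)))

/-- A polynomial is presented by its nonzero terms, listed in any order. -/
def PolyRep {k : ℕ} (f : MvPolynomial (Fin k) ℤ) (d : Data) : Prop :=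
  ∃ l : List (Fin k →₀ ℕ), l.Nodup ∧ (∀ e, e ∈ l ↔ e ∈ f.support) ∧
    d = Data.ofList (l.map fun e => termData (f.coeff e) e)

/-- A quotient is presented by its numerator and its denominator. -/
def FracRep {k : ℕ} (a : Frac k) (d : Data) : Prop :=
  ∃ d₁ d₂, PolyRep a.num d₁ ∧ PolyRep a.den d₂ ∧ d = Data.cons d₁ d₂

/-- The names of the operations. -/
def Op.data : Op → Data
  | Op.add => Data.cons Data.nil Data.nil
  | Op.sub => Data.cons Data.nil (Data.cons Data.nil Data.nil)
  | Op.mul => Data.cons (Data.cons Data.nil Data.nil) Data.nil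
  | Op.div => Data.cons (Data.cons Data.nil Data.nil) (Data.cons Data.nil Data.nil)

/-- Expression trees with empty leaves. -/
def ExprTree.data : ExprTree Unit → Data
  | ExprTree.leaf _ => Data.nil
  | ExprTree.node o l r => Data.cons o.data (Data.cons l.data r.data)

/-- The additional data of an instance. -/
def Extra.data (ops : Set Op) : (var : Variant) → Extra ops var → Data
  | Variant.std, _ => Data.nil
  | Variant.el, _ => Data.nil
  | Variant.eo, D => D.val.data

/-- Presentation of an instance with values in fractions: values, target, additional data. -/
def InstanceRep {ops : Set Op} {var : Variant} {k : ℕ} (I : Instance ops var (Frac k))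
    (d : Data) : Prop :=
  ∃ d₁ d₂, ListRep FracRep I.values d₁ ∧ FracRep I.target d₂ ∧
    d = Data.cons d₁ (Data.cons d₂ (Extra.data ops var I.extra))

/-- Presentation of an instance over `ℚ(x₁, …, x_k)`. -/
def RatInstance.Rep {ops : Set Op} {var : Variant} {k : ℕ} (I : RatInstance ops var k)
    (d : Data) : Prop :=
  InstanceRep I.inst d

end AEC

open AEC

/-! Fix a tree with fractions at its leaves and compute its numerator and denominator without
cancellation (`ExprTree.frac`). They are integer polynomials, the same ones whichever field the tree
is evaluated in. The tree is defined if and only if the uncancelled numerator of every divisor is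
nonzero, and it has value `t` if and only if `t.num * E.frac.den - E.frac.num * t.den` vanishes. So
solvability depends only on which of finitely many integer polynomials are zero, and the
substitution is correct as soon as it kills none of the nonzero ones.

Two estimates ensure this. The coefficient norm `norm1` is subadditive and submultiplicative, so for
`n` leaves of norm at most `C` the uncancelled polynomials have norm at most half of `(2 * C) ^ n`
(`norm1_frac_le`). And a nonzero polynomial of norm at most `B` stays nonzero under `x_k = B`,
because the top power of `B` outweighs all the others (`substPoly_ne_zero`). The criterion is proved
once, in `evaluates_target_iff`, for any homomorphism to a field that kills no nonzero polynomial of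
norm at most `B`. `exists_isSubst` applies it to the inclusion into the rational functions and to
the substitution followed by the inclusion; the right-hand sides agree.

For the complexity claims, `PT` is shown to be closed under the usual list and number operations.
The workhorse is `PT.foldl`, which bounds a loop provided that all intermediate results stay
polynomially small. The bound and the substitution are then written as functions on lists of terms,
and shown to be correct for every order of the terms. -/

namespace AEC

open MvPolynomial

/-! ### The coefficient norm. -/

section Norm

variable {σ : Type*}

/-- The sum of the absolute values of the coefficients. -/
def norm1 (f : MvPolynomial σ ℤ) : ℕ := ∑ e ∈ f.support, (f.coeff e).natAbs

lemma norm1_eq_sum_of_subset {f : MvPolynomial σ ℤ} {s : Finset (σ →₀ ℕ)} (h : f.support ⊆ s) :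
    norm1 f = ∑ e ∈ s, (f.coeff e).natAbs :=
  Finset.sum_subset h fun e _ he => by simpa using he

lemma norm1_zero : norm1 (0 : MvPolynomial σ ℤ) = 0 := by simp [norm1]

lemma norm1_add_le (f g : MvPolynomial σ ℤ) : norm1 (f + g) ≤ norm1 f + norm1 g := by
  classical
  rw [norm1_eq_sum_of_subset (f := f + g) (s := f.support ∪ g.support) support_add,
    norm1_eq_sum_of_subset (f := f) (s := f.support ∪ g.support) Finset.subset_union_left,
    norm1_eq_sum_of_subset (f := g) (s := f.support ∪ g.support) Finset.subset_union_right,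
    ← Finset.sum_add_distrib]
  exact Finset.sum_le_sum fun e _ => by rw [coeff_add]; exact Int.natAbs_add_le _ _

lemma norm1_neg (f : MvPolynomial σ ℤ) : norm1 (-f) = norm1 f := by
  simp [norm1, support_neg]

lemma norm1_sub_le (f g : MvPolynomial σ ℤ) : norm1 (f - g) ≤ norm1 f + norm1 g := by
  rw [sub_eq_add_neg, ← norm1_neg g]
  exact norm1_add_le _ _

lemma norm1_sum_le {ι : Type*} (s : Finset ι) (f : ι → MvPolynomial σ ℤ) :
    norm1 (∑ i ∈ s, f i) ≤ ∑ i ∈ s, norm1 (f i) :=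
  Finset.le_sum_of_subadditive norm1 norm1_zero.le norm1_add_le s f

lemma norm1_monomial_le (e : σ →₀ ℕ) (c : ℤ) : norm1 (monomial e c) ≤ c.natAbs := by
  classical
  rw [norm1_eq_sum_of_subset (s := {e}) support_monomial_subset]
  simp

lemma norm1_mul_le (f g : MvPolynomial σ ℤ) : norm1 (f * g) ≤ norm1 f * norm1 g := by
  have h : f * g = ∑ a ∈ f.support, ∑ b ∈ g.support, monomial (a + b) (f.coeff a * g.coeff b) := by
    conv_lhs => rw [f.as_sum, g.as_sum, Finset.sum_mul_sum]
    simp [monomial_mul]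
  rw [h]
  refine (norm1_sum_le _ _).trans ?_
  rw [norm1, norm1, Finset.sum_mul_sum]
  refine Finset.sum_le_sum fun a _ => (norm1_sum_le _ _).trans (Finset.sum_le_sum fun b _ => ?_)
  exact (norm1_monomial_le _ _).trans_eq (Int.natAbs_mul _ _)

end Norm

/-! ### Substituting a large integer for the last variable. -/

/-- The exponent vector without its last entry. -/
noncomputable def initExp {k : ℕ} (e : Fin (k + 1) →₀ ℕ) : Fin k →₀ ℕ :=
  Finsupp.equivFunOnFinite.symm fun i => e i.castSucc

@[simp] lemma initExp_apply {k : ℕ} (e : Fin (k + 1) →₀ ℕ) (i : Fin k) :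
    initExp e i = e i.castSucc := rfl

lemma exp_ext {k : ℕ} {e e' : Fin (k + 1) →₀ ℕ} (h : initExp e = initExp e')
    (hl : e (Fin.last k) = e' (Fin.last k)) : e = e' := by
  ext i
  induction i using Fin.lastCases with
  | last => exact hl
  | cast i => exact DFunLike.congr_fun h i

lemma substPoly_eq_sum {k : ℕ} (B : ℕ) (f : MvPolynomial (Fin (k + 1)) ℤ) :
    substPoly B f =
      ∑ e ∈ f.support, monomial (initExp e) (f.coeff e * (B : ℤ) ^ e (Fin.last k)) := by
  rw [substPoly, aeval_def, eval₂_eq']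
  refine Finset.sum_congr rfl fun e _ => ?_
  rw [Fin.prod_univ_castSucc, Fin.lastCases_last, ← map_pow, mul_comm (∏ _, _), ← mul_assoc,
    algebraMap_eq, ← C_mul, monomial_eq, Finsupp.prod_fintype _ _ fun _ => pow_zero _]
  simp

lemma coeff_substPoly {k : ℕ} (B : ℕ) (f : MvPolynomial (Fin (k + 1)) ℤ) (e' : Fin k →₀ ℕ) :
    (substPoly B f).coeff e' =
      ∑ e ∈ f.support, if initExp e = e' then f.coeff e * (B : ℤ) ^ e (Fin.last k) else 0 := by
  classical
  simp [substPoly_eq_sum, coeff_sum, coeff_monomial]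

/-- Take a term `c x^m` with the highest power `d` of the last variable. Every other term with the
same remaining exponents has a lower power, so after the substitution their sum is at most `(norm1 f
- |c|) * B ^ (d - 1)` in absolute value. This is less than `|c| * B ^ d`, so the coefficient cannot
cancel. -/
lemma substPoly_ne_zero {k : ℕ} {B : ℕ} {f : MvPolynomial (Fin (k + 1)) ℤ} (hf : f ≠ 0)
    (hB : norm1 f ≤ B) : substPoly B f ≠ 0 := by
  classical
  obtain ⟨m, hm, hmax⟩ := Finset.exists_max_image f.support (fun e => e (Fin.last k))
    (support_nonempty.2 hf)
  intro h0
  have h := coeff_substPoly B f (initExp m)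
  rw [h0, coeff_zero, ← Finset.add_sum_erase _ _ hm, if_pos rfl] at h
  set d := m (Fin.last k)
  have hc : 1 ≤ (f.coeff m).natAbs := Nat.one_le_iff_ne_zero.2 (by simpa using hm)
  have hsum : (f.coeff m).natAbs + ∑ e ∈ f.support.erase m, (f.coeff e).natAbs = norm1 f :=
    Finset.add_sum_erase f.support (fun e => (f.coeff e).natAbs) hm
  have hB1 : 1 ≤ B := by omega
  set S := ∑ e ∈ f.support.erase m,
    if initExp e = initExp m then f.coeff e * (B : ℤ) ^ e (Fin.last k) else 0
  -- The factor `B` stays on the left to avoid the exponent `d - 1`, which would be truncated at `d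
  -- = 0`.
  have hS : S.natAbs * B ≤ (∑ e ∈ f.support.erase m, (f.coeff e).natAbs) * B ^ d := by
    have h1 : S.natAbs ≤ ∑ e ∈ f.support.erase m,
        (if initExp e = initExp m then f.coeff e * (B : ℤ) ^ e (Fin.last k) else 0).natAbs :=
      Finset.le_sum_of_subadditive Int.natAbs (by simp) Int.natAbs_add_le _ _
    refine (Nat.mul_le_mul_right B h1).trans ?_
    rw [Finset.sum_mul, Finset.sum_mul]
    refine Finset.sum_le_sum fun e he => ?_
    split_ifs with hi
    · have hlt : e (Fin.last k) < d :=
        lt_of_le_of_ne (hmax e (Finset.mem_of_mem_erase he)) fun hl =>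
          Finset.ne_of_mem_erase he (exp_ext hi hl)
      rw [Int.natAbs_mul, Int.natAbs_pow, Int.natAbs_natCast, mul_assoc, ← pow_succ]
      exact Nat.mul_le_mul_left _ (Nat.pow_le_pow_right hB1 hlt)
    · simp
  have hSm : S.natAbs = (f.coeff m).natAbs * B ^ d := by
    have : S = -(f.coeff m * (B : ℤ) ^ d) := by linarith
    rw [this, Int.natAbs_neg, Int.natAbs_mul, Int.natAbs_pow, Int.natAbs_natCast]
  have hpos : 0 < B ^ d := Nat.pow_pos hB1
  have h2 : (f.coeff m).natAbs * B ≤ ∑ e ∈ f.support.erase m, (f.coeff e).natAbs := by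
    refine Nat.le_of_mul_le_mul_right ?_ hpos
    rw [hSm] at hS
    calc _ = (f.coeff m).natAbs * B ^ d * B := by ring
      _ ≤ _ := hS
  nlinarith

/-! ### Bounding the norm by degree and largest coefficient. -/

lemma degree_le_totalDegree {f : MvPolynomial (Fin k) ℤ} {e : Fin k →₀ ℕ} (h : e ∈ f.support) :
    e.degree ≤ f.totalDegree := by
  simpa [Finsupp.degree_eq_sum, Finsupp.sum_fintype] using le_totalDegree h

/-- Homogenisation: an extra exponent `d - e.degree` turns monomials of degree at most `d` into
monomials of degree exactly `d` in `k + 1` variables, which stars and bars count. -/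
lemma card_support_le {k d : ℕ} {f : MvPolynomial (Fin k) ℤ} (h : f.totalDegree ≤ d) :
    f.support.card ≤ (d + k).choose d := by
  classical
  have hcard := Finset.card_finsuppAntidiag_nat_eq_choose
    (s := (Finset.univ : Finset (Fin (k + 1)))) (n := d)
  have hle : f.support.card ≤ ((Finset.univ : Finset (Fin (k + 1))).finsuppAntidiag d).card := by
    refine Finset.card_le_card_of_injOn (fun e => Finsupp.cons (d - e.degree) e) ?_ ?_
    · intro e he
      have hed : e.degree ≤ d := (degree_le_totalDegree he).trans h
      simp only [Finset.mem_coe, Finset.mem_finsuppAntidiag, Finset.subset_univ, and_true]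
      rw [Fin.sum_univ_succ]
      simp only [Finsupp.cons_zero, Finsupp.cons_succ, ← Finsupp.degree_eq_sum]
      omega
    · intro a _ b _ hab
      simpa using congrArg Finsupp.tail hab
  refine hle.trans ?_
  rw [hcard]
  simp [add_comm]

lemma natAbs_coeff_le {k : ℕ} (f : MvPolynomial (Fin k) ℤ) (e : Fin k →₀ ℕ) :
    (f.coeff e).natAbs ≤ maxcoeff f := by
  by_cases he : e ∈ f.support
  · exact Finset.le_sup (f := fun e => (f.coeff e).natAbs) he
  · simp [notMem_support_iff.1 he]

lemma norm1_le {k d : ℕ} {f : MvPolynomial (Fin k) ℤ} (h : f.totalDegree ≤ d) :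
    norm1 f ≤ (d + k).choose d * maxcoeff f :=
  (Finset.sum_le_card_nsmul _ _ _ fun e _ => natAbs_coeff_le f e).trans
    (Nat.mul_le_mul_right _ (card_support_le h))

lemma maxcoeff_pos {k : ℕ} {f : MvPolynomial (Fin k) ℤ} (h : f ≠ 0) : 0 < maxcoeff f := by
  obtain ⟨e, he⟩ := ne_zero_iff.1 h
  exact (Int.natAbs_pos.2 he).trans_le (natAbs_coeff_le f e)

namespace Frac

variable {k : ℕ}

lemma norm1_num_le (a : Frac k) : norm1 a.num ≤ a.terms * a.maxc :=
  (norm1_le (d := a.deg) (le_max_left _ _)).trans (Nat.mul_le_mul_left _ (le_max_left _ _))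

lemma norm1_den_le (a : Frac k) : norm1 a.den ≤ a.terms * a.maxc :=
  (norm1_le (d := a.deg) (le_max_right _ _)).trans (Nat.mul_le_mul_left _ (le_max_right _ _))

lemma terms_pos (a : Frac k) : 0 < a.terms := Nat.choose_pos (Nat.le_add_right _ _)

lemma maxc_pos {a : Frac k} (h : a.den ≠ 0) : 0 < a.maxc :=
  (maxcoeff_pos h).trans_le (le_max_right _ _)

end Frac

/-! ### Lifting expression trees along a map of labels. -/

namespace ExprTree

/-- Relabel the leaves. -/
def map {V W : Type} (φ : V → W) : ExprTree V → ExprTree W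
  | leaf a => leaf (φ a)
  | node o l r => node o (l.map φ) (r.map φ)

section Map

variable {V W : Type} (φ : V → W)

lemma leaves_map (E : ExprTree V) : (E.map φ).leaves = E.leaves.map φ := by
  induction E with
  | leaf a => rfl
  | node o l r hl hr => simp [map, leaves, hl, hr]

lemma shape_map (E : ExprTree V) : (E.map φ).shape = E.shape := by
  induction E with
  | leaf a => rfl
  | node o l r hl hr => simp [map, shape, hl, hr]

lemma opsIn_map (ops : Set Op) (E : ExprTree V) : (E.map φ).OpsIn ops ↔ E.OpsIn ops := by
  induction E with
  | leaf a => rfl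
  | node o l r hl hr => simp [map, OpsIn, hl, hr]

lemma exists_map_eq (E : ExprTree W) (vals : List V) (h : E.leaves = vals.map φ) :
    ∃ F : ExprTree V, F.map φ = E ∧ F.leaves = vals := by
  induction E generalizing vals with
  | leaf a =>
    obtain ⟨v, rfl, hv⟩ : ∃ v, vals = [v] ∧ φ v = a := by
      simpa [leaves, eq_comm, List.map_eq_singleton_iff] using h
    exact ⟨leaf v, by simp [map, hv], rfl⟩
  | node o l r hl hr =>
    obtain ⟨u, v, rfl, hu, hv⟩ := List.map_eq_append_iff.1 h.symm
    obtain ⟨F, rfl, hF⟩ := hl u hu.symm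
    obtain ⟨G, rfl, hG⟩ := hr v hv.symm
    exact ⟨node o F G, rfl, by simp [leaves, hF, hG]⟩

end Map

lemma leaves_length_pos {V : Type} (E : ExprTree V) : 0 < E.leaves.length := by
  induction E with
  | leaf a => simp [leaves]
  | node o l r hl hr => simp [leaves]; omega

end ExprTree

lemma exists_perm_map_eq {V W : Type} (φ : V → W) {l : List W} {vals : List V}
    (h : l.Perm (vals.map φ)) : ∃ l' : List V, l'.map φ = l ∧ l'.Perm vals := by
  obtain ⟨l', h1, h2⟩ := List.perm_comp_forall₂ (r := fun w v => w = φ v) h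
    (v := vals) (by simp [List.forall₂_map_left_iff, List.forall₂_same])
  refine ⟨l', ?_, h2⟩
  rw [← List.forall₂_eq_eq_eq, List.forall₂_map_left_iff]
  exact h1.flip.imp fun _ _ h => h.symm

-- This puts the instances over both fields on a common footing: both are tested on the same trees,
-- labelled by fractions. Different fractions may have the same value, so a lift has to be chosen,
-- matching the permutation of the leaves.
open ExprTree in
lemma Instance.solvable_map_iff {ops : Set Op} {var : Variant} {V L : Type} [Field L] (φ : V → L)
    (I : Instance ops var V) :
    (I.map φ).Solvable ↔
      ∃ E : ExprTree V, Allowed ops I.values E var I.extra ∧ (E.map φ).Evaluates (φ I.target) := by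
  constructor
  · rintro ⟨E, hE, hv⟩
    obtain ⟨vals, t, D⟩ := I
    cases var with
    | std =>
      obtain ⟨l, hl, hp⟩ := exists_perm_map_eq φ hE.2
      obtain ⟨F, rfl, rfl⟩ := exists_map_eq φ E l hl.symm
      exact ⟨F, ⟨(opsIn_map φ ops F).1 hE.1, hp⟩, hv⟩
    | eo =>
      obtain ⟨l, hl, hp⟩ := exists_perm_map_eq φ hE.2
      obtain ⟨F, rfl, rfl⟩ := exists_map_eq φ E l hl.symm
      exact ⟨F, ⟨(shape_map φ F).symm.trans hE.1, hp⟩, hv⟩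
    | el =>
      obtain ⟨F, rfl, hF⟩ := exists_map_eq φ E vals hE.2
      exact ⟨F, ⟨(opsIn_map φ ops F).1 hE.1, hF⟩, hv⟩
  · rintro ⟨E, hE, hv⟩
    refine ⟨E.map φ, ?_, hv⟩
    obtain ⟨vals, t, D⟩ := I
    cases var with
    | std => exact ⟨(opsIn_map φ ops E).2 hE.1, by rw [leaves_map]; exact hE.2.map φ⟩
    | eo => exact ⟨(shape_map φ E).trans hE.1, by rw [leaves_map]; exact hE.2.map φ⟩
    | el => exact ⟨(opsIn_map φ ops E).2 hE.1, by rw [leaves_map]; exact congrArg _ hE.2⟩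

/-! ### Evaluation by uncancelled fractions. -/

namespace ExprTree

variable {k : ℕ}

/-- Numerator and denominator of an expression, computed without cancellation. -/
noncomputable def frac : ExprTree (Frac k) → Frac k
  | leaf a => a
  | node Op.add l r => ⟨l.frac.num * r.frac.den + r.frac.num * l.frac.den, l.frac.den * r.frac.den⟩
  | node Op.sub l r => ⟨l.frac.num * r.frac.den - r.frac.num * l.frac.den, l.frac.den * r.frac.den⟩
  | node Op.mul l r => ⟨l.frac.num * r.frac.num, l.frac.den * r.frac.den⟩
  | node Op.div l r => ⟨l.frac.num * r.frac.den, l.frac.den * r.frac.num⟩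

/-- No division has a right operand whose uncancelled numerator is the zero polynomial. -/
def Defined : ExprTree (Frac k) → Prop
  | leaf _ => True
  | node Op.div l r => l.Defined ∧ r.Defined ∧ r.frac.num ≠ 0
  | node _ l r => l.Defined ∧ r.Defined

/-- The factor 2 absorbs the two summands in the numerator of a sum or difference. If twice the
norms are at most `X` and `Y`, each product has norm at most `X * Y / 4`, and twice the sum of two
such products is again at most `X * Y`. -/
lemma norm1_frac_le {C : ℕ} (E : ExprTree (Frac k))
    (h : ∀ a ∈ E.leaves, norm1 a.num ≤ C ∧ norm1 a.den ≤ C) :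
    2 * norm1 E.frac.num ≤ (2 * C) ^ E.leaves.length ∧
      2 * norm1 E.frac.den ≤ (2 * C) ^ E.leaves.length := by
  induction E with
  | leaf a =>
    have := h a (by simp [leaves])
    simp only [frac, leaves, List.length_singleton, pow_one]
    omega
  | node o l r hl hr =>
    obtain ⟨h1, h2⟩ := hl fun a ha => h a (by simp [leaves, ha])
    obtain ⟨h3, h4⟩ := hr fun a ha => h a (by simp [leaves, ha])
    simp only [leaves, List.length_append, pow_add]
    set X := (2 * C) ^ l.leaves.length
    set Y := (2 * C) ^ r.leaves.length
    have mul {f g : MvPolynomial (Fin k) ℤ} (hf : 2 * norm1 f ≤ X) (hg : 2 * norm1 g ≤ Y) :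
        4 * norm1 (f * g) ≤ X * Y := by
      have := norm1_mul_le f g
      nlinarith [Nat.mul_le_mul hf hg]
    cases o with
    | add =>
      have := mul h1 h4
      have h5 := mul h2 h3
      have h6 := mul h2 h4
      have := norm1_add_le (l.frac.num * r.frac.den) (r.frac.num * l.frac.den)
      rw [mul_comm l.frac.den r.frac.num] at h5
      simp only [frac]
      omega
    | sub =>
      have := mul h1 h4
      have h5 := mul h2 h3
      have h6 := mul h2 h4
      have := norm1_sub_le (l.frac.num * r.frac.den) (r.frac.num * l.frac.den)
      rw [mul_comm l.frac.den r.frac.num] at h5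
      simp only [frac]
      omega
    | mul =>
      have := mul h1 h3
      have := mul h2 h4
      simp only [frac]
      omega
    | div =>
      have := mul h1 h4
      have := mul h2 h3
      simp only [frac]
      omega

section Hom

variable {L : Type} [Field L] (φ : MvPolynomial (Fin k) ℤ →+* L)

/-- The value of a fraction under a ring homomorphism to a field. -/
noncomputable def homVal (a : Frac k) : L := φ a.num / φ a.den

/-- Definedness, the value and the nonvanishing of the denominator have to be carried through one
induction: the rules for adding and dividing fractions need nonzero denominators, and those of a
quotient come from the numerator of its divisor. -/
lemma evaluates_map_iff {B C : ℕ} (hφ : ∀ f, norm1 f ≤ B → φ f = 0 → f = 0) (hC : 1 ≤ C)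
    (E : ExprTree (Frac k)) (hB : (2 * C) ^ E.leaves.length ≤ B)
    (h : ∀ a ∈ E.leaves, norm1 a.num ≤ C ∧ norm1 a.den ≤ C) (hd : ∀ a ∈ E.leaves, φ a.den ≠ 0)
    (v : L) :
    ((E.map (homVal φ)).Evaluates v ↔ E.Defined ∧ v = homVal φ E.frac) ∧
      (E.Defined → φ E.frac.den ≠ 0) := by
  induction E generalizing v with
  | leaf a =>
    refine ⟨⟨fun hv => ?_, ?_⟩, fun _ => hd a (by simp [leaves])⟩
    · cases hv
      exact ⟨trivial, rfl⟩
    · rintro ⟨-, rfl⟩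
      exact Evaluates.leaf _
  | node o l r hl hr =>
    have hlB : (2 * C) ^ l.leaves.length ≤ B :=
      le_trans (Nat.pow_le_pow_right (by omega) (by simp [leaves])) hB
    have hrB : (2 * C) ^ r.leaves.length ≤ B :=
      le_trans (Nat.pow_le_pow_right (by omega) (by simp [leaves])) hB
    have hln : ∀ a ∈ l.leaves, norm1 a.num ≤ C ∧ norm1 a.den ≤ C :=
      fun a ha => h a (by simp [leaves, ha])
    have hrn : ∀ a ∈ r.leaves, norm1 a.num ≤ C ∧ norm1 a.den ≤ C :=
      fun a ha => h a (by simp [leaves, ha])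
    have hl := hl hlB hln fun a ha => hd a (by simp [leaves, ha])
    have hr := hr hrB hrn fun a ha => hd a (by simp [leaves, ha])
    -- This half of the induction hypothesis does not involve `v`, so `0` is an arbitrary choice.
    have hl2 := (hl 0).2
    have hr2 := (hr 0).2
    have hl1 := fun v => (hl v).1
    have hr1 := fun v => (hr v).1
    -- The only use of `hφ`: a divisor is zero in the field exactly when its uncancelled numerator
    -- is the zero polynomial.
    have hrz : φ r.frac.num ≠ 0 ↔ r.frac.num ≠ 0 := by
      refine not_congr ⟨hφ _ ?_, fun h0 => by rw [h0, map_zero]⟩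
      have := (norm1_frac_le r hrn).1
      omega
    simp only [map]
    cases o with
    | add =>
      simp only [Defined, frac, homVal, map_add, map_mul]
      refine ⟨⟨fun hv => ?_, ?_⟩, fun ⟨h1, h2⟩ => mul_ne_zero (hl2 h1) (hr2 h2)⟩
      · cases hv with
        | add hx hy =>
          obtain ⟨h1, rfl⟩ := (hl1 _).1 hx
          obtain ⟨h2, rfl⟩ := (hr1 _).1 hy
          have := hl2 h1
          have := hr2 h2
          refine ⟨⟨h1, h2⟩, ?_⟩
          simp only [homVal]
          field_simp
      · rintro ⟨⟨h1, h2⟩, rfl⟩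
        have := hl2 h1
        have := hr2 h2
        convert Evaluates.add ((hl1 _).2 ⟨h1, rfl⟩) ((hr1 _).2 ⟨h2, rfl⟩) using 1
        simp only [homVal]
        field_simp
    | sub =>
      simp only [Defined, frac, homVal, map_sub, map_mul]
      refine ⟨⟨fun hv => ?_, ?_⟩, fun ⟨h1, h2⟩ => mul_ne_zero (hl2 h1) (hr2 h2)⟩
      · cases hv with
        | sub hx hy =>
          obtain ⟨h1, rfl⟩ := (hl1 _).1 hx
          obtain ⟨h2, rfl⟩ := (hr1 _).1 hy
          have := hl2 h1
          have := hr2 h2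
          refine ⟨⟨h1, h2⟩, ?_⟩
          simp only [homVal]
          field_simp
      · rintro ⟨⟨h1, h2⟩, rfl⟩
        have := hl2 h1
        have := hr2 h2
        convert Evaluates.sub ((hl1 _).2 ⟨h1, rfl⟩) ((hr1 _).2 ⟨h2, rfl⟩) using 1
        simp only [homVal]
        field_simp
    | mul =>
      simp only [Defined, frac, homVal, map_mul]
      refine ⟨⟨fun hv => ?_, ?_⟩, fun ⟨h1, h2⟩ => mul_ne_zero (hl2 h1) (hr2 h2)⟩
      · cases hv with
        | mul hx hy =>
          obtain ⟨h1, rfl⟩ := (hl1 _).1 hx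
          obtain ⟨h2, rfl⟩ := (hr1 _).1 hy
          exact ⟨⟨h1, h2⟩, div_mul_div_comm _ _ _ _⟩
      · rintro ⟨⟨h1, h2⟩, rfl⟩
        convert Evaluates.mul ((hl1 _).2 ⟨h1, rfl⟩) ((hr1 _).2 ⟨h2, rfl⟩) using 1
        exact (div_mul_div_comm _ _ _ _).symm
    | div =>
      simp only [Defined, frac, homVal, map_mul]
      refine ⟨⟨fun hv => ?_, ?_⟩, fun ⟨h1, h2, h3⟩ => mul_ne_zero (hl2 h1) (hrz.2 h3)⟩
      · cases hv with
        | div hx hy hy0 =>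
          obtain ⟨h1, rfl⟩ := (hl1 _).1 hx
          obtain ⟨h2, rfl⟩ := (hr1 _).1 hy
          refine ⟨⟨h1, h2, fun h0 => hy0 (by rw [homVal, h0, map_zero, zero_div])⟩,
            div_div_div_eq _ _ _ _⟩
      · rintro ⟨⟨h1, h2, h3⟩, rfl⟩
        convert Evaluates.div ((hl1 _).2 ⟨h1, rfl⟩) ((hr1 _).2 ⟨h2, rfl⟩)
          (div_ne_zero (hrz.2 h3) (hr2 h2)) using 1
        exact (div_div_div_eq _ _ _ _).symm

/-- The point is that the right-hand side does not mention `φ`. After cross-multiplication the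
difference has norm at most `N * (2 * C) ^ n`, since each of its two products contributes at most
half of that. -/
lemma evaluates_target_iff {B C N : ℕ} (hφ : ∀ f, norm1 f ≤ B → φ f = 0 → f = 0) (hC : 1 ≤ C)
    (E : ExprTree (Frac k)) (t : Frac k) (hN : 1 ≤ N) (htn : norm1 t.num ≤ N)
    (htd : norm1 t.den ≤ N) (hB : N * (2 * C) ^ E.leaves.length ≤ B)
    (h : ∀ a ∈ E.leaves, norm1 a.num ≤ C ∧ norm1 a.den ≤ C) (hd : ∀ a ∈ E.leaves, φ a.den ≠ 0)
    (ht : φ t.den ≠ 0) :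
    (E.map (homVal φ)).Evaluates (homVal φ t) ↔
      E.Defined ∧ t.num * E.frac.den - E.frac.num * t.den = 0 := by
  have hB' : (2 * C) ^ E.leaves.length ≤ B := le_trans (Nat.le_mul_of_pos_left _ hN) hB
  obtain ⟨h1, h2⟩ := evaluates_map_iff φ hφ hC E hB' h hd (homVal φ t)
  rw [h1]
  refine and_congr_right fun hE => ?_
  rw [homVal, homVal, div_eq_div_iff ht (h2 hE), ← sub_eq_zero, ← map_mul, ← map_mul, ← map_sub]
  refine ⟨hφ _ ?_, fun h0 => by rw [h0, map_zero]⟩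
  obtain ⟨h3, h4⟩ := norm1_frac_le E h
  have h5 := norm1_sub_le (t.num * E.frac.den) (E.frac.num * t.den)
  have h6 := norm1_mul_le t.num E.frac.den
  have h7 := norm1_mul_le E.frac.num t.den
  have h8 := Nat.mul_le_mul htn h4
  have h9 := Nat.mul_le_mul htd h3
  nlinarith

end Hom

end ExprTree

/-! ### The two homomorphisms to be compared, and the explicit bound. -/

section Homs

variable {k : ℕ}

/-- The inclusion of the integer polynomials in the rational functions. -/
noncomputable def toRatFun (k : ℕ) : MvPolynomial (Fin k) ℤ →+* RatFun k :=
  (algebraMap (MvPolynomial (Fin k) ℚ) (RatFun k)).comp (MvPolynomial.map (Int.castRingHom ℚ))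

lemma toRatFun_injective (k : ℕ) : Function.Injective (toRatFun k) :=
  (IsFractionRing.injective (MvPolynomial (Fin k) ℚ) (RatFun k)).comp
    (map_injective _ Int.cast_injective)

lemma toRatFun_eq_zero {f : MvPolynomial (Fin k) ℤ} : toRatFun k f = 0 ↔ f = 0 :=
  map_eq_zero_iff _ (toRatFun_injective k)

/-- Substitution for the last variable, as a ring homomorphism. -/
noncomputable def substHom (k B : ℕ) : MvPolynomial (Fin (k + 1)) ℤ →+* MvPolynomial (Fin k) ℤ :=
  (MvPolynomial.aeval
    (Fin.lastCases (motive := fun _ => MvPolynomial (Fin k) ℤ)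
      (MvPolynomial.C (B : ℤ)) (fun i => MvPolynomial.X i)) : _ →ₐ[ℤ] _).toRingHom

lemma homVal_toRatFun : ExprTree.homVal (toRatFun k) = Frac.val := rfl

lemma homVal_subst (B : ℕ) :
    ExprTree.homVal ((toRatFun k).comp (substHom k B)) = Frac.val ∘ Frac.subst B := rfl

end Homs

lemma foldr_max_map_le {α : Type} {l : List α} {g : α → ℕ} {n : ℕ} (h : ∀ a ∈ l, g a ≤ n) :
    (l.map g).foldr max 0 ≤ n := by
  induction l with
  | nil => simp
  | cons a l ih => simp_all

lemma le_foldr_max_map {α : Type} {l : List α} {g : α → ℕ} {a : α} (h : a ∈ l) :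
    g a ≤ (l.map g).foldr max 0 := by
  induction l with
  | nil => simp at h
  | cons b l ih =>
    rcases List.mem_cons.1 h with rfl | h
    · simp
    · simpa using Or.inr (ih h)

namespace RatInstance

variable {ops : Set Op} {var : Variant} {k : ℕ}

lemma bound_pos (I : RatInstance ops var k) : 0 < I.bound := by
  unfold bound
  refine Nat.mul_pos (Nat.mul_pos (Nat.mul_pos two_pos I.inst.target.terms_pos)
    (Frac.maxc_pos I.target_den)) ?_
  -- Without values the last factor is `0 ^ 0 = 1`.
  rcases hv : I.inst.values with _ | ⟨a, l⟩
  · simp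
  · refine Nat.pow_pos (Nat.mul_pos (Nat.mul_pos two_pos ?_) ?_)
    · simp [a.terms_pos]
    · have := Frac.maxc_pos (I.values_den a (by simp [hv]))
      simp [this]

lemma terms_le_sum {l : List (Frac k)} {a : Frac k} (h : a ∈ l) :
    a.terms ≤ (l.map Frac.terms).sum :=
  List.single_le_sum (by simp) _ (List.mem_map_of_mem h)

lemma exists_isSubst (I : RatInstance ops var (k + 1)) {B : ℕ} (hB : I.bound ≤ B) :
    ∃ J : RatInstance ops var k, I.IsSubst B J ∧ (I.Solvable ↔ J.Solvable) := by
  set C := (I.inst.values.map Frac.terms).sum * (I.inst.values.map Frac.maxc).foldr max 0 with hC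
  set N := I.inst.target.terms * I.inst.target.maxc with hN
  have hb : I.bound = 2 * (N * (2 * C) ^ I.inst.values.length) := by
    simp only [bound, hC, hN]; ring
  have hleaf : ∀ a ∈ I.inst.values, norm1 a.num ≤ C ∧ norm1 a.den ≤ C := fun a ha => by
    have := Nat.mul_le_mul (terms_le_sum ha) (le_foldr_max_map (g := Frac.maxc) ha)
    exact ⟨a.norm1_num_le.trans this, a.norm1_den_le.trans this⟩
  have hN1 : 1 ≤ N := Nat.mul_pos I.inst.target.terms_pos (Frac.maxc_pos I.target_den)
  have hpos : 0 < (2 * C) ^ I.inst.values.length := by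
    have := I.bound_pos
    rw [hb] at this
    exact Nat.pos_of_ne_zero fun h => by simp [h] at this
  -- The leading factor 2 of the bound is not needed here.
  have hNB : N * (2 * C) ^ I.inst.values.length ≤ B := by omega
  have hNB' : N ≤ B := (Nat.le_mul_of_pos_right _ hpos).trans hNB
  have hCB : ∀ a ∈ I.inst.values, 1 ≤ C ∧ C ≤ B := fun a ha => by
    have hlen : I.inst.values.length ≠ 0 := by
      intro h; simp [List.length_eq_zero_iff.1 h] at ha
    have h1 : 2 * C ≤ (2 * C) ^ I.inst.values.length := Nat.le_self_pow hlen _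
    have h2 : 1 ≤ C := by
      by_contra h
      have : C = 0 := by omega
      simp [this, hlen] at hpos
    have h3 : 1 * (2 * C) ^ I.inst.values.length ≤ N * (2 * C) ^ I.inst.values.length :=
      Nat.mul_le_mul_right _ hN1
    omega
  have hvd : ∀ a ∈ I.inst.values, substPoly B a.den ≠ 0 := fun a ha =>
    substPoly_ne_zero (I.values_den a ha) ((hleaf a ha).2.trans (hCB a ha).2)
  have htd : substPoly B I.inst.target.den ≠ 0 :=
    substPoly_ne_zero I.target_den (I.inst.target.norm1_den_le.trans hNB')
  let J : RatInstance ops var k := ⟨I.inst.map (Frac.subst B), by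
    intro a ha
    obtain ⟨b, hb, rfl⟩ := List.mem_map.1 ha
    exact hvd b hb, htd⟩
  refine ⟨J, rfl, ?_⟩
  have hJ : J.Solvable ↔ (I.inst.map (Frac.val ∘ Frac.subst B)).Solvable := by
    have : J.inst.map Frac.val = I.inst.map (Frac.val ∘ Frac.subst B) := by
      simp [J, Instance.map]
    rw [Solvable, this]
  -- Both sides now range over the same allowed trees, so these can be compared one at a time.
  rw [hJ, Solvable, Instance.solvable_map_iff, Instance.solvable_map_iff]
  refine exists_congr fun E => and_congr_right fun hE => ?_
  have hperm : E.leaves.Perm I.inst.values := by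
    revert hE
    generalize I.inst.extra = D
    intro hE
    cases var with
    | std => exact hE.2
    | eo => exact hE.2
    | el => exact List.Perm.of_eq hE.2
  have hmem : ∀ a ∈ E.leaves, a ∈ I.inst.values := fun a ha => hperm.subset ha
  -- If there are no values then `C = 0`; but a tree has a leaf, so an allowed tree excludes that
  -- case.
  have hC1 : 1 ≤ C := by
    obtain ⟨a, ha⟩ := List.exists_mem_of_length_pos E.leaves_length_pos
    exact (hCB a (hmem a ha)).1
  have hE' : N * (2 * C) ^ E.leaves.length ≤ B := by rw [hperm.length_eq]; exact hNB
  have e1 := ExprTree.evaluates_target_iff (toRatFun (k + 1)) (B := B)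
    (fun f _ h => toRatFun_eq_zero.1 h) hC1 E I.inst.target hN1 I.inst.target.norm1_num_le
    I.inst.target.norm1_den_le hE' (fun a ha => hleaf a (hmem a ha))
    (fun a ha => toRatFun_eq_zero.not.2 (I.values_den a (hmem a ha)))
    (toRatFun_eq_zero.not.2 I.target_den)
  have e2 := ExprTree.evaluates_target_iff ((toRatFun k).comp (substHom k B)) (B := B)
    (fun f hf h => by
      by_contra h0
      exact substPoly_ne_zero h0 hf (toRatFun_eq_zero.1 h)) hC1 E I.inst.target hN1
    I.inst.target.norm1_num_le I.inst.target.norm1_den_le hE' (fun a ha => hleaf a (hmem a ha))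
    (fun a ha => toRatFun_eq_zero.not.2 (hvd a (hmem a ha))) (toRatFun_eq_zero.not.2 htd)
  rw [homVal_toRatFun] at e1
  rw [homVal_subst] at e2
  exact e1.trans e2.symm

end RatInstance

end AEC

/-! ### Cost calculus for programs and closure properties of polynomial time. -/

namespace AEC

lemma Data.size_pos (x : Data) : 0 < x.size := by cases x <;> simp [Data.size]

lemma Data.size_head_lt (x : Data) : x.head.size < x.size + 1 := by
  cases x <;> simp [Data.size, Data.head]; omega

lemma Data.size_tail_lt (x : Data) : x.tail.size < x.size + 1 := by
  cases x <;> simp [Data.size, Data.tail]; omega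

lemma Data.size_ofList (l : List Data) :
    (Data.ofList l).size = (l.map fun a => a.size + 1).sum + 1 := by
  induction l with
  | nil => rfl
  | cons a l ih => simp [Data.ofList, Data.size, ih]; omega

/-- Since each rule charges for the size of its input, a cost bound is also a size bound; this is
what makes polynomial bounds compose. -/
lemma Runs.size_le {p : Prog} {x y : Data} {c : ℕ} (h : Runs p x y c) : y.size ≤ c := by
  induction h with
  | nil x => simp [Data.size]
  | id x => omega
  | head x => exact (Data.size_head_lt x).le
  | tail x => exact (Data.size_tail_lt x).le
  | pair _ _ h1 h2 => have := Data.size_pos; simp only [Data.size]; omega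
  | seq _ _ h1 h2 => omega
  | cond_true _ _ _ h1 h2 => omega
  | cond_false _ _ h1 h2 => omega
  | loop_stop _ h => omega
  | loop_step _ _ _ _ h1 h2 h3 => omega

lemma eval_nat_mono (T : Polynomial ℕ) {m n : ℕ} (h : m ≤ n) : T.eval m ≤ T.eval n := by
  rw [Polynomial.eval_eq_sum, Polynomial.eval_eq_sum]
  exact Finset.sum_le_sum fun i _ => Nat.mul_le_mul_left _ (Nat.pow_le_pow_left h i)

/-- The program `p` maps `x` to `y`, at a cost bounded by `T` at the size of `x`. -/
def Computes (p : Prog) (T : Polynomial ℕ) (x y : Data) : Prop :=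
  ∃ c, Runs p x y c ∧ c ≤ T.eval x.size

namespace Computes

open Polynomial

variable {p q r : Prog} {T U V : Polynomial ℕ} {x y z : Data}

lemma size_le (h : Computes p T x y) : y.size ≤ T.eval x.size := by
  obtain ⟨c, hc, hT⟩ := h
  exact hc.size_le.trans hT

lemma nil (x : Data) : Computes Prog.nil (X + 1) x Data.nil := ⟨_, Runs.nil x, by simp⟩

lemma id (x : Data) : Computes Prog.id (X + 1) x x := ⟨_, Runs.id x, by simp⟩

lemma head (x : Data) : Computes Prog.head (X + 1) x x.head := ⟨_, Runs.head x, by simp⟩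

lemma tail (x : Data) : Computes Prog.tail (X + 1) x x.tail := ⟨_, Runs.tail x, by simp⟩

lemma pair (hp : Computes p T x y) (hq : Computes q U x z) :
    Computes (Prog.pair p q) (T + U + (X + 1)) x (Data.cons y z) := by
  obtain ⟨c, hc, hT⟩ := hp
  obtain ⟨d, hd, hU⟩ := hq
  exact ⟨_, Runs.pair hc hd, by simp; omega⟩

lemma seq (hp : Computes p T x y) (hq : Computes q U y z) :
    Computes (Prog.seq p q) (T + U.comp T + (X + 1)) x z := by
  obtain ⟨c, hc, hT⟩ := hp
  obtain ⟨d, hd, hU⟩ := hq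
  have := eval_nat_mono U (hc.size_le.trans hT)
  exact ⟨_, Runs.seq hc hd, by simp only [eval_add, eval_comp, eval_X, eval_one]; omega⟩

/-- The bound also includes a polynomial for the branch not taken, so that one polynomial serves for
both outcomes of the test. -/
lemma cond_true {v : Data} (hr : Computes r V x v) (hv : v ≠ Data.nil) (hp : Computes p T x y) :
    Computes (Prog.cond r p q) (V + T + U + (X + 1)) x y := by
  obtain ⟨c, hc, hT⟩ := hr
  obtain ⟨d, hd, hU⟩ := hp
  exact ⟨_, Runs.cond_true hc hv hd, by simp; omega⟩

lemma cond_false (hr : Computes r V x Data.nil) (hq : Computes q U x y) :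
    Computes (Prog.cond r p q) (V + T + U + (X + 1)) x y := by
  obtain ⟨c, hc, hT⟩ := hr
  obtain ⟨d, hd, hU⟩ := hq
  exact ⟨_, Runs.cond_false hc hd, by simp; omega⟩

/-- A common size bound `K` for all states is required: iterating the bound `T` of a single step
would not give a polynomial. -/
lemma loop_aux (N K : ℕ) (x : ℕ → Data)
    (hr : ∀ i < N, ∃ v, v ≠ Data.nil ∧ Computes r V (x i) v)
    (hN : Computes r V (x N) Data.nil) (hp : ∀ i < N, Computes p T (x i) (x (i + 1)))
    (hK : ∀ i ≤ N, (x i).size ≤ K) :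
    ∃ c, Runs (Prog.loop r p) (x 0) (x N) c ∧
      c ≤ (N + 1) * (V.eval K + T.eval K + (K + 1)) := by
  induction N generalizing x with
  | zero =>
    obtain ⟨m, hm, hV⟩ := hN
    have h0 := hK 0 le_rfl
    have := eval_nat_mono V h0
    exact ⟨_, Runs.loop_stop hm, by omega⟩
  | succ N ih =>
    obtain ⟨c, hc, hcK⟩ := ih (fun i => x (i + 1)) (fun i hi => hr (i + 1) (by omega)) hN
      (fun i hi => hp (i + 1) (by omega)) (fun i hi => hK (i + 1) (by omega))
    obtain ⟨v, hv, m, hm, hV⟩ := hr 0 (by omega)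
    obtain ⟨n, hn, hT⟩ := hp 0 (by omega)
    have h0 := hK 0 (by omega)
    have := eval_nat_mono V h0
    have := eval_nat_mono T h0
    refine ⟨_, Runs.loop_step hm hv hn hc, ?_⟩
    rw [Nat.succ_mul]
    omega

end Computes

/-- A presentation of the elements of `α` by trees. -/
class Enc (α : Type) where
  /-- the tree which presents an element -/
  enc : α → Data

open Enc

instance : Enc Data := ⟨id⟩
-- With this choice the code of a `List Unit` is the unary notation of its length.
instance : Enc Unit := ⟨fun _ => Data.nil⟩
instance : Enc Bool := ⟨Data.ofBool⟩
instance : Enc ℕ := ⟨Data.ofNat⟩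
instance : Enc ℤ := ⟨Data.ofInt⟩
instance {α β : Type} [Enc α] [Enc β] : Enc (α × β) := ⟨fun x => Data.cons (enc x.1) (enc x.2)⟩
instance {α : Type} [Enc α] : Enc (List α) := ⟨fun l => Data.ofList (l.map enc)⟩

variable {α β γ σ : Type} [Enc α] [Enc β] [Enc γ] [Enc σ]

lemma enc_prod (a : α) (b : β) : enc (a, b) = Data.cons (enc a) (enc b) := rfl
lemma enc_nil : enc ([] : List α) = Data.nil := rfl
lemma enc_cons (a : α) (l : List α) : enc (a :: l) = Data.cons (enc a) (enc l) := rfl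

/-- The size of the presentation. -/
abbrev esize (a : α) : ℕ := (enc a).size

lemma esize_prod (a : α) (b : β) : esize (a, b) = esize a + esize b + 1 := rfl

lemma esize_list (l : List α) : esize l = (l.map fun a => esize a + 1).sum + 1 := by
  simp [esize, enc, Data.size_ofList, Function.comp_def]

lemma esize_cons (a : α) (l : List α) : esize (a :: l) = esize a + esize l + 1 := rfl

lemma esize_reverse (l : List α) : esize l.reverse = esize l := by
  simp [esize_list, List.sum_reverse]

lemma esize_le_of_sublist {l l' : List α} (h : l.Sublist l') : esize l ≤ esize l' := by
  rw [esize_list, esize_list]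
  exact Nat.succ_le_succ ((h.map _).sum_le_sum (by simp))

lemma esize_le_of_mem {a : α} {l : List α} (h : a ∈ l) : esize a ≤ esize l := by
  rw [esize_list]
  have := List.single_le_sum (l := l.map fun a => esize a + 1) (by simp) _ (List.mem_map_of_mem h)
  omega

lemma length_le_esize (l : List α) : l.length ≤ esize l := by
  induction l with
  | nil => simp
  | cons a l ih => rw [esize_cons]; simp; omega

/-- `f` is computable in polynomial time. -/
@[fun_prop]
def PT (f : α → β) : Prop :=
  ∃ (p : Prog) (T : Polynomial ℕ), ∀ a, Computes p T (enc a) (enc (f a))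

namespace PT

open Polynomial

lemma exists_esize_le {f : α → β} (hf : PT f) :
    ∃ P : Polynomial ℕ, ∀ a, esize (f a) ≤ P.eval (esize a) := by
  obtain ⟨p, T, h⟩ := hf
  exact ⟨T, fun a => (h a).size_le⟩

lemma congr {f g : α → β} (hf : PT f) (h : ∀ a, f a = g a) : PT g := (funext h : f = g) ▸ hf

@[fun_prop]
lemma id' : PT fun a : α => a := ⟨_, _, fun _ => Computes.id _⟩

lemma of_enc_eq {f : α → β} (h : ∀ a, enc (f a) = enc a) : PT f :=
  ⟨Prog.id, X + 1, fun a => by rw [h]; exact Computes.id _⟩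

@[fun_prop]
lemma comp {g : β → γ} {f : α → β} (hg : PT g) (hf : PT f) : PT fun a => g (f a) := by
  obtain ⟨p, T, hp⟩ := hf
  obtain ⟨q, U, hq⟩ := hg
  exact ⟨_, _, fun a => (hp a).seq (hq _)⟩

@[fun_prop]
lemma const (b : β) : PT fun _ : α => b := by
  obtain ⟨p, T, h⟩ : ∃ (p : Prog) (T : Polynomial ℕ), ∀ a : α, Computes p T (enc a) (enc b) := by
    generalize enc b = d
    induction d with
    | nil => exact ⟨_, _, fun a => Computes.nil _⟩
    | cons d e ihd ihe =>
      obtain ⟨p, T, hp⟩ := ihd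
      obtain ⟨q, U, hq⟩ := ihe
      exact ⟨_, _, fun a => (hp a).pair (hq a)⟩
  exact ⟨p, T, h⟩

@[fun_prop]
lemma mk {f : σ → α} {g : σ → β} (hf : PT f) (hg : PT g) : PT fun s => (f s, g s) := by
  obtain ⟨p, T, hp⟩ := hf
  obtain ⟨q, U, hq⟩ := hg
  exact ⟨_, _, fun a => (hp a).pair (hq a)⟩

@[fun_prop]
lemma fst {f : σ → α × β} (hf : PT f) : PT fun s => (f s).1 :=
  comp (g := Prod.fst) ⟨_, _, fun _ => Computes.head _⟩ hf

@[fun_prop]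
lemma snd {f : σ → α × β} (hf : PT f) : PT fun s => (f s).2 :=
  comp (g := Prod.snd) ⟨_, _, fun _ => Computes.tail _⟩ hf

@[fun_prop]
lemma cons {f : σ → α} {g : σ → List α} (hf : PT f) (hg : PT g) : PT fun s => f s :: g s := by
  obtain ⟨p, T, hp⟩ := hf
  obtain ⟨q, U, hq⟩ := hg
  exact ⟨_, _, fun a => (hp a).pair (hq a)⟩

@[fun_prop]
lemma cond {c : σ → Bool} {f g : σ → α} (hc : PT c) (hf : PT f) (hg : PT g) :
    PT fun s => bif c s then f s else g s := by
  obtain ⟨r, V, hr⟩ := hc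
  obtain ⟨p, T, hp⟩ := hf
  obtain ⟨q, U, hq⟩ := hg
  refine ⟨Prog.cond r p q, V + T + U + (X + 1), fun s => ?_⟩
  have h := hr s
  rcases hcs : c s with _ | _
  · rw [hcs] at h
    simpa only [hcs, cond_false] using Computes.cond_false h (hq s)
  · rw [hcs] at h
    simpa only [hcs, cond_true] using Computes.cond_true h Data.noConfusion (hp s)

/-- A nonempty list has the same code as the pair of its head and tail, so the code of `l s` serves
both as the test and as the argument of `g`. -/
lemma listCases {l : σ → List α} {f : σ → β} {g : σ → α → List α → β} (hl : PT l) (hf : PT f)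
    (hg : PT fun p : σ × α × List α => g p.1 p.2.1 p.2.2) :
    PT fun s => (l s).casesOn (motive := fun _ => β) (f s) (g s) := by
  obtain ⟨r, V, hr⟩ := hl
  obtain ⟨p, T, hp⟩ := hf
  obtain ⟨q, U, hq⟩ := hg
  obtain ⟨q', U', hq'⟩ : ∃ q' U', ∀ s a t, l s = a :: t → Computes q' U' (enc s) (enc (g s a t)) :=
    ⟨_, _, fun s a t h => ((Computes.id _).pair (h ▸ hr s)).seq (hq (s, a, t))⟩
  refine ⟨Prog.cond r q' p, V + U' + T + (X + 1), fun s => ?_⟩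
  have h := hr s
  rcases hls : l s with _ | ⟨a, t⟩
  · rw [hls] at h
    simpa only [hls] using Computes.cond_false h (hp s)
  · rw [hls] at h
    simpa only [hls] using Computes.cond_true h Data.noConfusion (hq' s a t hls)

/-- A loop on states (parameter, accumulator, rest of the list). The bound `P` on the accumulator
after every prefix cannot be dropped: a polynomial-time step may square the accumulator's value, or
double its length, each time. -/
lemma foldl {l : σ → List α} {b : σ → β} {f : σ → β → α → β} (hl : PT l) (hb : PT b)
    (hf : PT fun p : σ × β × α => f p.1 p.2.1 p.2.2) (P : Polynomial ℕ)
    (hP : ∀ s l', l' <+: l s → esize (l'.foldl (f s) (b s)) ≤ P.eval (esize s)) :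
    PT fun s => (l s).foldl (f s) (b s) := by
  obtain ⟨q, U, hq⟩ := hl
  obtain ⟨r, V, hr⟩ := hb
  obtain ⟨p, T, hp⟩ := hf
  obtain ⟨ps, Ts, step⟩ : ∃ ps Ts, ∀ (s : σ) (c : β) (a : α) (t : List α),
      Computes ps Ts (enc (s, c, a :: t)) (enc (s, f s c a, t)) :=
    ⟨_, _, fun s c a t => (Computes.head (enc (s, c, a :: t))).pair
      ((((Computes.head _).pair (((Computes.tail _).seq (Computes.head _)).pair
        (((Computes.tail _).seq (Computes.tail _)).seq (Computes.head _)))).seq (hp (s, c, a))).pair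
      (((Computes.tail _).seq (Computes.tail _)).seq (Computes.tail _)))⟩
  obtain ⟨pt, Vt, test⟩ : ∃ pt Vt, ∀ (s : σ) (c : β) (t : List α),
      Computes pt Vt (enc (s, c, t)) (enc t) :=
    ⟨_, _, fun s c t => (Computes.tail (enc (s, c, t))).seq (Computes.tail _)⟩
  obtain ⟨pi, Ti, init⟩ : ∃ pi Ti, ∀ s : σ, Computes pi Ti (enc s) (enc (s, b s, l s)) :=
    ⟨_, _, fun s => (Computes.id (enc s)).pair ((hr s).pair (hq s))⟩
  have main (s : σ) : ∃ c, Runs (Prog.loop pt ps) (enc (s, b s, l s))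
      (enc (s, (l s).foldl (f s) (b s), ([] : List α))) c ∧
      c ≤ ((U + 1) * (Vt.comp (X + P + U + 2) + Ts.comp (X + P + U + 2) + (X + P + U + 2 + 1))).eval
        (esize s) := by
    let x (i : ℕ) := enc (s, ((l s).take i).foldl (f s) (b s), (l s).drop i)
    have htest (i : ℕ) (hi : i < (l s).length) : ∃ v, v ≠ Data.nil ∧ Computes pt Vt (x i) v :=
      ⟨enc ((l s).drop i), by rw [List.drop_eq_getElem_cons hi, enc_cons]; exact nofun,
        test _ _ _⟩
    have hend : Computes pt Vt (x (l s).length) Data.nil := by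
      have := test s (((l s).take (l s).length).foldl (f s) (b s)) ((l s).drop (l s).length)
      rwa [List.drop_length, enc_nil, ← List.drop_length (l := l s)] at this
    have hstep (i : ℕ) (hi : i < (l s).length) : Computes ps Ts (x i) (x (i + 1)) := by
      have := step s (((l s).take i).foldl (f s) (b s)) (l s)[i] ((l s).drop (i + 1))
      simp only [x]
      rw [List.drop_eq_getElem_cons hi, ← List.take_concat_get' _ _ hi, List.foldl_append]
      exact this
    have hsize (i : ℕ) (_ : i ≤ (l s).length) : (x i).size ≤ (X + P + U + 2).eval (esize s) := by
      have h1 := hP s _ (List.take_prefix i (l s))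
      have h2 := esize_le_of_sublist (List.drop_sublist i (l s))
      have h3 : esize (l s) ≤ U.eval (esize s) := (hq s).size_le
      have h4 : (x i).size =
        esize s + (esize (((l s).take i).foldl (f s) (b s)) + esize ((l s).drop i) + 1) + 1 := rfl
      rw [h4]
      simp only [eval_add, eval_X, eval_ofNat]
      omega
    obtain ⟨c, hc, hcK⟩ := Computes.loop_aux _ _ x htest hend hstep hsize
    simp only [x, List.take_zero, List.foldl_nil, List.drop_zero, List.take_length,
      List.drop_length] at hc
    refine ⟨c, hc, hcK.trans ?_⟩
    simp only [eval_mul, eval_add, eval_comp, eval_X, eval_one, eval_ofNat]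
    exact Nat.mul_le_mul_right _ (Nat.succ_le_succ ((length_le_esize _).trans (hq s).size_le))
  refine ⟨_, _, fun s => Computes.seq (p := Prog.seq pi (Prog.loop pt ps)) (T := Ti + (U + 1) *
    (Vt.comp (X + P + U + 2) + Ts.comp (X + P + U + 2) + (X + P + U + 2 + 1)) + (X + 1)) ?_
    ((Computes.tail (enc (s, (l s).foldl (f s) (b s), ([] : List α)))).seq (Computes.head _))⟩
  obtain ⟨c, hc, hcK⟩ := main s
  obtain ⟨d, hd, hdK⟩ := init s
  refine ⟨_, Runs.seq hd hc, ?_⟩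
  change c ≤ eval (enc s).size _ at hcK
  simp only [eval_add, eval_X, eval_one] at hcK ⊢
  omega

@[fun_prop]
lemma reverse {l : σ → List α} (hl : PT l) : PT fun s => (l s).reverse := by
  obtain ⟨P, hP⟩ := hl.exists_esize_le
  refine congr (foldl (b := fun _ => []) (f := fun _ b a => a :: b) hl (const _) (by fun_prop) P
    fun s l' h => ?_) fun s => List.foldl_flip_cons_eq_append.trans (by simp)
  rw [List.foldl_flip_cons_eq_append]
  simp only [List.map_id_fun', id_eq, List.append_nil]
  rw [esize_reverse]
  exact (esize_le_of_sublist h.sublist).trans (hP s)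

lemma map {l : σ → List α} {f : σ → α → β} (hl : PT l)
    (hf : PT fun p : σ × α => f p.1 p.2) : PT fun s => (l s).map (f s) := by
  obtain ⟨P, hP⟩ := hl.exists_esize_le
  obtain ⟨Q, hQ⟩ := hf.exists_esize_le
  have key (s : σ) (l : List α) : l.foldl (fun b a => f s a :: b) [] = (l.map (f s)).reverse := by
    simp
  -- The size bound: at most `P` entries, each of size at most `Q` at the size of the pair `(s, a)`.
  refine congr (reverse (foldl (b := fun _ => []) (f := fun s b a => f s a :: b) hl (const _)
    (cons (hf.comp (f := fun p : σ × List β × α => (p.1, p.2.2)) (by fun_prop)) (by fun_prop))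
    (P * (Q.comp (X + P + 1) + 1) + 1)
    fun s l' h => ?_)) fun s => by rw [key, List.reverse_reverse]
  rw [key, esize_reverse, esize_list, List.map_map]
  simp only [eval_add, eval_mul, eval_comp, eval_X, eval_one]
  refine Nat.succ_le_succ ((List.sum_le_card_nsmul _ (Q.eval (esize s + P.eval (esize s) + 1) + 1)
    fun x hx => ?_).trans ?_)
  · obtain ⟨a, ha, rfl⟩ := List.mem_map.1 hx
    refine Nat.succ_le_succ ((hQ (s, a)).trans (eval_nat_mono Q ?_))
    rw [esize_prod]
    have := (esize_le_of_mem (h.subset ha)).trans (hP s)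
    omega
  · rw [List.length_map, smul_eq_mul]
    refine Nat.mul_le_mul_right _ ?_
    exact h.length_le.trans ((length_le_esize _).trans (hP s))

lemma filter {l : σ → List α} {f : σ → α → Bool} (hl : PT l)
    (hf : PT fun p : σ × α => f p.1 p.2) : PT fun s => (l s).filter (f s) := by
  obtain ⟨P, hP⟩ := hl.exists_esize_le
  have key (s : σ) (l : List α) (m : List α) :
      l.foldl (fun b a => bif f s a then a :: b else b) m = (l.filter (f s)).reverse ++ m := by
    induction l generalizing m with
    | nil => rfl
    | cons a l ih => rcases h : f s a with _ | _ <;> simp [ih, h]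
  refine congr (reverse (foldl (b := fun _ => []) (f := fun s b a => bif f s a then a :: b else b)
    hl (const _) (cond (hf.comp (f := fun p : σ × List α × α => (p.1, p.2.2)) (by fun_prop))
    (by fun_prop) (by fun_prop)) P
    fun s l' h => ?_)) fun s => by simp [key]
  rw [key, List.append_nil, esize_reverse]
  exact (esize_le_of_sublist ((List.filter_sublist).trans h.sublist)).trans (hP s)

@[fun_prop]
lemma append {l m : σ → List α} (hl : PT l) (hm : PT m) : PT fun s => l s ++ m s := by
  obtain ⟨P, hP⟩ := hl.exists_esize_le
  obtain ⟨Q, hQ⟩ := hm.exists_esize_le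
  refine congr (foldl (b := m) (f := fun _ b a => a :: b) (reverse hl) hm (by fun_prop) (P + Q)
    fun s l' h => ?_) fun s => List.foldl_flip_cons_eq_append.trans (by simp)
  rw [List.foldl_flip_cons_eq_append]
  have h1 := (esize_le_of_sublist h.sublist).trans_eq (esize_reverse _) |>.trans (hP s)
  have h2 := hQ s
  simp only [List.map_id_fun', id_eq, eval_add]
  rw [esize_list, List.map_append, List.sum_append, List.map_reverse, List.sum_reverse]
  rw [esize_list] at h1 h2
  omega

@[fun_prop]
lemma not {f : σ → Bool} (hf : PT f) : PT fun s => !f s :=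
  congr (cond hf (const false) (const true)) fun s => by cases f s <;> rfl

@[fun_prop]
lemma and {f g : σ → Bool} (hf : PT f) (hg : PT g) : PT fun s => f s && g s :=
  congr (cond hf hg (const false)) fun s => by cases f s <;> rfl

@[fun_prop]
lemma or {f g : σ → Bool} (hf : PT f) (hg : PT g) : PT fun s => f s || g s :=
  congr (cond hf (const true) hg) fun s => by cases f s <;> rfl

@[fun_prop]
lemma xor {f g : σ → Bool} (hf : PT f) (hg : PT g) : PT fun s => f s ^^ g s :=
  congr (cond hf (not hg) hg) fun s => by cases f s <;> simp

end PT

end AEC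

/-! ### Binary arithmetic on natural numbers. -/

namespace AEC

open Enc Polynomial

variable {α β γ σ : Type} [Enc α] [Enc β] [Enc γ] [Enc σ]

lemma esize_bool_le (b : Bool) : esize b ≤ 3 := by cases b <;> decide

lemma esize_bools_le (l : List Bool) : esize l ≤ 4 * l.length + 1 := by
  induction l with
  | nil => simp [esize, enc_nil, Data.size]
  | cons b l ih =>
    have := esize_bool_le b
    rw [esize_cons, List.length_cons]
    omega

lemma esize_nat_le_of_lt {n m : ℕ} (h : n < 2 ^ m) : esize n ≤ 4 * m + 1 := by
  have h1 : esize n ≤ 4 * n.bits.length + 1 := esize_bools_le n.bits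
  rw [Nat.size_eq_bits_len] at h1
  have := Nat.size_le.2 h
  omega

lemma lt_two_pow_esize (n : ℕ) : n < 2 ^ esize n := by
  rw [← Nat.size_le, ← Nat.size_eq_bits_len]
  exact length_le_esize n.bits

lemma esize_nat_mono {m n : ℕ} (h : m ≤ n) : esize m ≤ 4 * esize n + 1 :=
  esize_nat_le_of_lt (h.trans_lt (lt_two_pow_esize n))

/-- The value of a list of bits, the most significant one first. -/
def msbVal (l : List Bool) : ℕ := l.foldl (fun n b => Nat.bit b n) 0

lemma msbVal_append (l : List Bool) (b : Bool) : msbVal (l ++ [b]) = Nat.bit b (msbVal l) := by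
  simp [msbVal]

lemma msbVal_lt (l : List Bool) : msbVal l < 2 ^ l.length := by
  induction l using List.reverseRecOn with
  | nil => simp [msbVal]
  | append_singleton l b ih =>
    rw [msbVal_append, Nat.bit_val, List.length_append, List.length_singleton, pow_succ]
    cases b <;> simp <;> omega

lemma msbVal_cons (b : Bool) (l : List Bool) :
    msbVal (b :: l) = b.toNat * 2 ^ l.length + msbVal l := by
  induction l using List.reverseRecOn with
  | nil => simp [msbVal, Nat.bit_val]
  | append_singleton l c ih =>
    rw [← List.cons_append, msbVal_append, msbVal_append, ih, Nat.bit_val, Nat.bit_val,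
      List.length_append, List.length_singleton, pow_succ]
    ring

lemma msbVal_bits_reverse (n : ℕ) : msbVal n.bits.reverse = n := by
  induction n using Nat.binaryRec' with
  | zero => rfl
  | bit b n h ih => rw [Nat.bits_append_bit _ _ h, List.reverse_cons, msbVal_append, ih]

namespace PT

@[fun_prop]
lemma bits {f : σ → ℕ} (hf : PT f) : PT fun s => (f s).bits :=
  comp (g := Nat.bits) (of_enc_eq fun _ => rfl) hf

/-- A number and its list of bits have the same code by definition. -/
lemma of_bits {f : σ → ℕ} (hf : PT fun s => (f s).bits) : PT f := hf

@[fun_prop]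
lemma isEmpty {l : σ → List α} (hl : PT l) : PT fun s => (l s).isEmpty :=
  congr (listCases (f := fun _ => true) (g := fun _ _ _ => false) hl (const _) (const _))
    fun s => by cases l s <;> rfl

@[fun_prop]
lemma tail {l : σ → List α} (hl : PT l) : PT fun s => (l s).tail :=
  congr (listCases (f := fun _ => []) (g := fun _ _ t => t) hl (const _) (by fun_prop))
    fun s => by cases l s <;> rfl

@[fun_prop]
lemma headI [Inhabited α] {l : σ → List α} (hl : PT l) : PT fun s => (l s).headI :=
  congr (listCases (f := fun _ => default) (g := fun _ a _ => a) hl (const _) (by fun_prop))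
    fun s => by cases l s <;> rfl

@[fun_prop]
lemma bodd {f : σ → ℕ} (hf : PT f) : PT fun s => (f s).bodd :=
  congr (f := fun s => (f s).bits.headI) (by fun_prop) fun s => (Nat.bodd_eq_bits_head _).symm

@[fun_prop]
lemma div2 {f : σ → ℕ} (hf : PT f) : PT fun s => (f s).div2 :=
  of_bits (congr (f := fun s => (f s).bits.tail) (by fun_prop)
    fun s => (Nat.div2_bits_eq_tail _).symm)

@[fun_prop]
lemma bit {b : σ → Bool} {f : σ → ℕ} (hb : PT b) (hf : PT f) : PT fun s => Nat.bit (b s) (f s) := by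
  -- The test avoids a leading zero: a `false` put before the empty list would not be the notation
  -- of `0`.
  refine of_bits (congr (f := fun s => bif (b s || !(f s).bits.isEmpty) then b s :: (f s).bits
    else []) (by fun_prop) fun s => ?_)
  by_cases h : f s = 0 → b s = true
  · rw [Nat.bits_append_bit _ _ h]
    rcases hb : b s with _ | _
    · have h0 : f s ≠ 0 := fun h0 => by simp [h h0] at hb
      have : (f s).bits ≠ [] := by
        rw [← List.length_pos_iff, Nat.size_eq_bits_len]
        exact Nat.size_pos.2 (Nat.pos_of_ne_zero h0)
      simp [List.isEmpty_eq_false_iff.2 this]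
    · simp
  · push Not at h
    simp [h.1, h.2]

lemma msbVal {l : σ → List Bool} (hl : PT l) : PT fun s => msbVal (l s) := by
  obtain ⟨P, hP⟩ := hl.exists_esize_le
  refine foldl (b := fun _ => 0) (f := fun _ n b => Nat.bit b n) hl (const _) (by fun_prop)
    (4 * P + 1) fun s l' h => ?_
  refine (esize_nat_le_of_lt (msbVal_lt l')).trans ?_
  have := h.length_le.trans ((length_le_esize _).trans (hP s))
  simp only [eval_add, eval_mul, eval_ofNat, eval_one]
  omega

end PT

/-- One step of the addition (or of the subtraction, if `neg` holds) of binary numbers: the state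
consists of the remaining parts of the numbers, the carry, and the bits of the result so far. -/
def ripple (neg : Bool) (s : ℕ × ℕ × Bool × List Bool) : ℕ × ℕ × Bool × List Bool :=
  (s.1.div2, s.2.1.div2,
    (((s.1.bodd ^^ neg) && (s.2.1.bodd || s.2.2.1)) || (s.2.1.bodd && s.2.2.1)),
    (s.1.bodd ^^ (s.2.1.bodd ^^ s.2.2.1)) :: s.2.2.2)

/-- The result of `l.length` steps. -/
def ripples (neg : Bool) (x y : ℕ) (l : List Bool) : ℕ × ℕ × Bool × List Bool :=
  l.foldl (fun s _ => ripple neg s) (x, y, false, [])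

lemma ripples_append (neg : Bool) (x y : ℕ) (l : List Bool) (b : Bool) :
    ripples neg x y (l ++ [b]) = ripple neg (ripples neg x y l) := by
  simp [ripples]

lemma ripples_fst (neg : Bool) (x y : ℕ) (l : List Bool) :
    (ripples neg x y l).1 = x / 2 ^ l.length ∧ (ripples neg x y l).2.1 = y / 2 ^ l.length ∧
      (ripples neg x y l).2.2.2.length = l.length := by
  induction l using List.reverseRecOn with
  | nil => simp [ripples]
  | append_singleton l b ih =>
    simp [ripples_append, ripple, ih, Nat.div2_val, Nat.div_div_eq_div_mul, pow_succ]

/-- The loop invariant of schoolbook addition and subtraction. The carry is the majority of the two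
low bits and the old carry; negating the bit of `x` in it yields the borrow. The step is checked on
all sixteen cases. -/
lemma ripples_invariant (neg : Bool) (x y : ℕ) (l : List Bool) :
    (msbVal (ripples neg x y l).2.2.2 : ℤ) + 2 ^ l.length * ((ripples neg x y l).1 +
      (bif neg then -1 else 1) * ((ripples neg x y l).2.1 + (ripples neg x y l).2.2.1.toNat)) =
    x + (bif neg then -1 else 1) * y := by
  induction l using List.reverseRecOn with
  | nil => simp [ripples, msbVal]
  | append_singleton l b ih =>
    have hlen := (ripples_fst neg x y l).2.2
    rw [ripples_append, ← ih]
    generalize ripples neg x y l = s at hlen ⊢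
    obtain ⟨u, v, c, out⟩ := s
    simp only at hlen
    simp only [ripple, msbVal_cons, List.length_append, List.length_singleton, pow_succ, hlen]
    have hu : (u : ℤ) = (u.bodd.toNat : ℤ) + 2 * (u.div2 : ℤ) := mod_cast (Nat.bodd_add_div2 u).symm
    have hv : (v : ℤ) = (v.bodd.toNat : ℤ) + 2 * (v.div2 : ℤ) := mod_cast (Nat.bodd_add_div2 v).symm
    rw [hu, hv]
    generalize u.bodd = a
    generalize v.bodd = d
    push_cast
    cases neg <;> cases a <;> cases d <;> cases c <;> simp <;> ring

/-- The list `x.bits ++ y.bits` only serves as a counter: it is at least as long as either number,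
so nothing remains of them. -/
lemma ripples_end (neg : Bool) (x y : ℕ) :
    (msbVal (ripples neg x y (x.bits ++ y.bits)).2.2.2 : ℤ) +
      2 ^ (x.bits ++ y.bits).length * ((bif neg then -1 else 1) *
        ((ripples neg x y (x.bits ++ y.bits)).2.2.1.toNat)) =
    x + (bif neg then -1 else 1) * y := by
  rw [← ripples_invariant neg x y (x.bits ++ y.bits)]
  obtain ⟨h1, h2, -⟩ := ripples_fst neg x y (x.bits ++ y.bits)
  have hx : x / 2 ^ (x.bits ++ y.bits).length = 0 := by
    refine Nat.div_eq_of_lt ((Nat.lt_size_self x).trans_le (Nat.pow_le_pow_right two_pos ?_))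
    simp [Nat.size_eq_bits_len]
  have hy : y / 2 ^ (x.bits ++ y.bits).length = 0 := by
    refine Nat.div_eq_of_lt ((Nat.lt_size_self y).trans_le (Nat.pow_le_pow_right two_pos ?_))
    simp [Nat.size_eq_bits_len]
  rw [h1, h2, hx, hy]
  simp

lemma add_eq_msbVal (x y : ℕ) : x + y = msbVal ((ripples false x y (x.bits ++ y.bits)).2.2.1 ::
    (ripples false x y (x.bits ++ y.bits)).2.2.2) := by
  have h := ripples_end false x y
  rw [msbVal_cons, (ripples_fst _ _ _ _).2.2]
  simp only [cond_false, one_mul] at h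
  have : (x + y : ℤ) = _ := h.symm
  zify
  rw [this]
  ring

/-- A borrow left at the end means that `x - y` is negative as an integer, as the output bits
represent less than the power of two that was borrowed. -/
lemma sub_eq_msbVal (x y : ℕ) : x - y = bif (ripples true x y (x.bits ++ y.bits)).2.2.1 then 0 else
    msbVal (ripples true x y (x.bits ++ y.bits)).2.2.2 := by
  have h := ripples_end true x y
  have hlt := msbVal_lt (ripples true x y (x.bits ++ y.bits)).2.2.2
  rw [(ripples_fst _ _ _ _).2.2] at hlt
  zify at hlt
  rcases hc : (ripples true x y (x.bits ++ y.bits)).2.2.1 with _ | _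
  · simp [hc] at h ⊢
    omega
  · simp [hc] at h hlt ⊢
    omega

namespace PT

@[fun_prop]
lemma ripples (neg : Bool) {x y : σ → ℕ} {l : σ → List Bool} (hx : PT x) (hy : PT y) (hl : PT l) :
    PT fun s => ripples neg (x s) (y s) (l s) := by
  obtain ⟨P, hP⟩ := hl.exists_esize_le
  obtain ⟨Q, hQ⟩ := hx.exists_esize_le
  obtain ⟨R, hR⟩ := hy.exists_esize_le
  refine foldl (b := fun s => (x s, y s, false, [])) (f := fun _ s _ => ripple neg s) hl
    (by fun_prop) (by unfold ripple; fun_prop) (4 * P + 4 * Q + 4 * R + 9) fun s l' h => ?_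
  obtain ⟨h1, h2, h3⟩ := ripples_fst neg (x s) (y s) l'
  have e1 := esize_nat_mono (h1.le.trans (Nat.div_le_self _ _))
  have e2 := esize_nat_mono (h2.le.trans (Nat.div_le_self _ _))
  have e3 := esize_bool_le (AEC.ripples neg (x s) (y s) l').2.2.1
  have e4 := esize_bools_le (AEC.ripples neg (x s) (y s) l').2.2.2
  have hlen := h.length_le.trans ((length_le_esize _).trans (hP s))
  have := hQ s
  have := hR s
  change esize (AEC.ripples neg (x s) (y s) l') ≤ _
  have e5 : esize (AEC.ripples neg (x s) (y s) l') = esize (AEC.ripples neg (x s) (y s) l').1 +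
    (esize (AEC.ripples neg (x s) (y s) l').2.1 + (esize (AEC.ripples neg (x s) (y s) l').2.2.1 +
      esize (AEC.ripples neg (x s) (y s) l').2.2.2 + 1) + 1) + 1 := rfl
  simp only [eval_add, eval_mul, eval_ofNat]
  omega

@[fun_prop]
lemma add {f g : σ → ℕ} (hf : PT f) (hg : PT g) : PT fun s => f s + g s :=
  congr (msbVal (l := fun s => (AEC.ripples false (f s) (g s) ((f s).bits ++ (g s).bits)).2.2.1 ::
    (AEC.ripples false (f s) (g s) ((f s).bits ++ (g s).bits)).2.2.2) (by fun_prop))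
    fun s => (add_eq_msbVal _ _).symm

@[fun_prop]
lemma sub {f g : σ → ℕ} (hf : PT f) (hg : PT g) : PT fun s => f s - g s :=
  congr (cond (c := fun s => (AEC.ripples true (f s) (g s) ((f s).bits ++ (g s).bits)).2.2.1)
    (by fun_prop) (const 0)
    (msbVal (l := fun s => (AEC.ripples true (f s) (g s) ((f s).bits ++ (g s).bits)).2.2.2)
      (by fun_prop))) fun s => (sub_eq_msbVal _ _).symm

@[fun_prop]
lemma max {f g : σ → ℕ} (hf : PT f) (hg : PT g) : PT fun s => max (f s) (g s) :=
  congr (f := fun s => f s + (g s - f s)) (by fun_prop) fun s => by omega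

-- Horner's scheme on the bits of the second factor, most significant first. The partial results are
-- `f s` times a prefix value, so their lengths stay additive.
@[fun_prop]
lemma mul {f g : σ → ℕ} (hf : PT f) (hg : PT g) : PT fun s => f s * g s := by
  obtain ⟨P, hP⟩ := hf.exists_esize_le
  obtain ⟨Q, hQ⟩ := hg.exists_esize_le
  have key (x : ℕ) (l : List Bool) :
      l.foldl (fun n b => n + n + bif b then x else 0) 0 = x * AEC.msbVal l := by
    induction l using List.reverseRecOn with
    | nil => rfl
    | append_singleton l b ih =>
      rw [List.foldl_append, ih, msbVal_append, Nat.bit_val]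
      cases b <;> simp <;> ring
  refine congr (foldl (l := fun s => (g s).bits.reverse) (b := fun _ => 0)
    (f := fun s n b => n + n + bif b then f s else 0) (by fun_prop) (const _) ?_
    (4 * (P + Q) + 1) fun s l' h => ?_) fun s => by rw [key, msbVal_bits_reverse]
  · exact add (by fun_prop) (cond (by fun_prop) (by fun_prop) (const _))
  · rw [key]
    have hlen := h.length_le.trans ((length_le_esize _).trans_eq (esize_reverse _))
    have e1 : esize (g s).bits = esize (g s) := rfl
    have : f s * AEC.msbVal l' < 2 ^ (esize (f s) + l'.length) := by
      rw [pow_add]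
      exact Nat.mul_lt_mul'' (lt_two_pow_esize _) (msbVal_lt _)
    have h1 := esize_nat_le_of_lt this
    have h2 := hP s
    have h3 := hQ s
    simp only [eval_add, eval_mul, eval_ofNat, eval_one]
    omega

-- The exponent is the length of a list, hence effectively unary, so the power has at most about
-- (size of the base) × (length) bits.
@[fun_prop]
lemma pow_length {f : σ → ℕ} {l : σ → List α} (hf : PT f) (hl : PT l) :
    PT fun s => f s ^ (l s).length := by
  obtain ⟨P, hP⟩ := hf.exists_esize_le
  obtain ⟨Q, hQ⟩ := hl.exists_esize_le
  have key (x : ℕ) (l : List α) : l.foldl (fun n _ => n * x) 1 = x ^ l.length := by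
    induction l using List.reverseRecOn with
    | nil => rfl
    | append_singleton l b ih => simp [ih, pow_succ]
  refine congr (foldl (b := fun _ => 1) (f := fun s n _ => n * f s) hl (const _) (by fun_prop)
    (4 * (P * Q + 1) + 1) fun s l' h => ?_) fun s => key _ _
  rw [key]
  have hlen := h.length_le.trans ((length_le_esize _).trans (hQ s))
  have : f s ^ l'.length < 2 ^ (P.eval (esize s) * Q.eval (esize s) + 1) := by
    refine (Nat.pow_le_pow_left (lt_two_pow_esize (f s)).le _).trans_lt ?_
    rw [← pow_mul]
    exact Nat.pow_lt_pow_right one_lt_two (Nat.lt_succ_of_le (Nat.mul_le_mul (hP s) hlen))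
  have h1 := esize_nat_le_of_lt this
  simpa only [eval_add, eval_mul, eval_ofNat, eval_one] using h1

end PT

end AEC

/-! ### Integers, sums, binomial coefficients and equality tests. -/

namespace AEC

open Enc Polynomial

variable {α β γ σ : Type} [Enc α] [Enc β] [Enc γ] [Enc σ]

lemma enc_int (z : ℤ) : enc z = enc (decide (z < 0), z.natAbs) := rfl

lemma esize_int_le (z : ℤ) : esize z ≤ esize z.natAbs + 4 := by
  have := esize_bool_le (decide (z < 0))
  rw [esize, enc_int, ← esize, esize_prod]
  omega

/-- Sizes add along a list, and the node of each `cons` supplies the factor 2 that the sum of two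
powers of two needs. -/
lemma nat_sum_lt (l : List ℕ) : l.sum < 2 ^ esize l := by
  induction l with
  | nil => simp
  | cons a l ih =>
    have h1 := lt_two_pow_esize a
    have h2 : 2 ^ esize a ≤ 2 ^ (esize a + esize l) := Nat.pow_le_pow_right two_pos (by omega)
    have h3 : 2 ^ esize l ≤ 2 ^ (esize a + esize l) := Nat.pow_le_pow_right two_pos (by omega)
    rw [List.sum_cons, esize_cons, pow_succ]
    omega

lemma int_sum_natAbs_lt (l : List ℤ) : l.sum.natAbs < 2 ^ esize l := by
  induction l with
  | nil => simp
  | cons a l ih =>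
    have h1 := lt_two_pow_esize a.natAbs
    have h0 : esize a.natAbs ≤ esize a := by
      rw [esize, esize, enc_int, ← esize, ← esize, esize_prod]
      omega
    have h2 : 2 ^ esize a.natAbs ≤ 2 ^ (esize a + esize l) :=
      Nat.pow_le_pow_right two_pos (by omega)
    have h3 : 2 ^ esize l ≤ 2 ^ (esize a + esize l) := Nat.pow_le_pow_right two_pos (by omega)
    rw [List.sum_cons, esize_cons, pow_succ]
    have := Int.natAbs_add_le a l.sum
    omega

lemma foldr_max_le_sum (l : List ℕ) : l.foldr max 0 ≤ l.sum := by
  induction l with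
  | nil => simp
  | cons a l ih => rw [List.foldr_cons, List.sum_cons]; omega

lemma esize_flatten_le (l : List (List α)) : esize l.flatten ≤ esize l := by
  induction l with
  | nil => exact le_rfl
  | cons a l ih =>
    rw [List.flatten_cons, esize_cons]
    have : esize (a ++ l.flatten) + 1 = esize a + esize l.flatten := by
      simp only [esize_list, List.map_append, List.sum_append]
      omega
    omega

namespace PT

lemma of_enc_congr {f : σ → α} {g : σ → β} (hf : PT f) (h : ∀ s, enc (f s) = enc (g s)) : PT g := by
  obtain ⟨p, T, hp⟩ := hf
  exact ⟨p, T, fun s => h s ▸ hp s⟩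

@[fun_prop]
lemma nat_isZero {f : σ → ℕ} (hf : PT f) : PT fun s => decide (f s = 0) := by
  refine congr (f := fun s => (f s).bits.isEmpty) (by fun_prop) fun s => ?_
  rw [Bool.eq_iff_iff, List.isEmpty_iff, ← List.length_eq_zero_iff, Nat.size_eq_bits_len,
    Nat.size_eq_zero, decide_eq_true_iff]

@[fun_prop]
lemma natAbs {f : σ → ℤ} (hf : PT f) : PT fun s => (f s).natAbs :=
  snd (f := fun s => (decide (f s < 0), (f s).natAbs)) (hf.of_enc_congr fun _ => enc_int _)

@[fun_prop]
lemma isNeg {f : σ → ℤ} (hf : PT f) : PT fun s => decide (f s < 0) :=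
  fst (f := fun s => (decide (f s < 0), (f s).natAbs)) (hf.of_enc_congr fun _ => enc_int _)

@[fun_prop]
lemma toNat {f : σ → ℤ} (hf : PT f) : PT fun s => (f s).toNat := by
  refine congr (f := fun s => bif decide (f s < 0) then 0 else (f s).natAbs) (by fun_prop)
    fun s => ?_
  by_cases h : f s < 0 <;> simp [h] <;> omega

@[fun_prop]
lemma neg_toNat {f : σ → ℤ} (hf : PT f) : PT fun s => (-f s).toNat := by
  refine congr (f := fun s => bif decide (f s < 0) then (f s).natAbs else 0) (by fun_prop)
    fun s => ?_
  by_cases h : f s < 0 <;> simp [h] <;> omega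

/-- Integer operations reduce to this one by writing `z` as `z.toNat - (-z).toNat`, which avoids
handling signs separately. -/
lemma natCast_sub {f g : σ → ℕ} (hf : PT f) (hg : PT g) : PT fun s => (f s : ℤ) - g s := by
  refine of_enc_congr (f := fun s => (!decide (g s - f s = 0),
    bif decide (g s - f s = 0) then f s - g s else g s - f s)) (by fun_prop) fun s => ?_
  rw [enc_int]
  by_cases h : g s - f s = 0
  · have h1 : ¬ (f s : ℤ) - g s < 0 := by omega
    have h2 : ((f s : ℤ) - g s).natAbs = f s - g s := by omega
    simp [h, h1, h2]
  · have h1 : (f s : ℤ) - g s < 0 := by omega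
    have h2 : ((f s : ℤ) - g s).natAbs = g s - f s := by omega
    simp [h, h1, h2]

@[fun_prop]
lemma int_add {f g : σ → ℤ} (hf : PT f) (hg : PT g) : PT fun s => f s + g s :=
  congr (natCast_sub (f := fun s => (f s).toNat + (g s).toNat)
    (g := fun s => (-f s).toNat + (-g s).toNat) (by fun_prop) (by fun_prop)) fun s => by omega

@[fun_prop]
lemma int_mul_natCast {f : σ → ℤ} {g : σ → ℕ} (hf : PT f) (hg : PT g) :
    PT fun s => f s * (g s : ℤ) := by
  refine congr (natCast_sub (f := fun s => (f s).toNat * g s)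
    (g := fun s => (-f s).toNat * g s) (by fun_prop) (by fun_prop)) fun s => ?_
  push_cast
  rw [← sub_mul]
  congr 1
  omega

@[fun_prop]
lemma int_isZero {f : σ → ℤ} (hf : PT f) : PT fun s => decide (f s = 0) :=
  congr (f := fun s => decide ((f s).natAbs = 0)) (by fun_prop) fun s => by simp

@[fun_prop]
lemma nat_sum {l : σ → List ℕ} (hl : PT l) : PT fun s => (l s).sum := by
  obtain ⟨P, hP⟩ := hl.exists_esize_le
  refine congr (foldl (b := fun _ => 0) (f := fun _ n m => n + m) hl (const _) (by fun_prop)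
    (4 * P + 1) fun s l' h => ?_) fun s => List.sum_eq_foldl.symm
  rw [← List.sum_eq_foldl]
  have h1 := esize_nat_le_of_lt (nat_sum_lt l')
  have h2 := (esize_le_of_sublist h.sublist).trans (hP s)
  simp only [eval_add, eval_mul, eval_ofNat, eval_one]
  omega

@[fun_prop]
lemma int_sum {l : σ → List ℤ} (hl : PT l) : PT fun s => (l s).sum := by
  obtain ⟨P, hP⟩ := hl.exists_esize_le
  refine congr (foldl (b := fun _ => 0) (f := fun _ n m => n + m) hl (const _) (by fun_prop)
    (4 * P + 5) fun s l' h => ?_) fun s => List.sum_eq_foldl.symm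
  rw [← List.sum_eq_foldl]
  have h1 := esize_nat_le_of_lt (int_sum_natAbs_lt l')
  have h2 := (esize_le_of_sublist h.sublist).trans (hP s)
  have h3 := esize_int_le l'.sum
  simp only [eval_add, eval_mul, eval_ofNat]
  omega

@[fun_prop]
lemma foldr_max {l : σ → List ℕ} (hl : PT l) : PT fun s => (l s).foldr Max.max 0 := by
  obtain ⟨P, hP⟩ := hl.exists_esize_le
  have key (l : List ℕ) : l.foldl Max.max 0 = l.foldr Max.max 0 := List.foldl_eq_foldr
  refine congr (foldl (b := fun _ => 0) (f := fun _ n m => Max.max n m) hl (const _)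
    (max (by fun_prop) (by fun_prop))
    (4 * P + 1) fun s l' h => ?_) fun s => key _
  rw [key]
  have h1 := esize_nat_le_of_lt ((foldr_max_le_sum l').trans_lt (nat_sum_lt l'))
  have h2 := (esize_le_of_sublist h.sublist).trans (hP s)
  simp only [eval_add, eval_mul, eval_ofNat, eval_one]
  exact h1.trans (by omega)

@[fun_prop]
lemma flatten {l : σ → List (List α)} (hl : PT l) : PT fun s => (l s).flatten := by
  obtain ⟨P, hP⟩ := hl.exists_esize_le
  have key (l : List (List α)) (m : List α) : l.foldl (· ++ ·) m = m ++ l.flatten := by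
    induction l generalizing m with
    | nil => simp
    | cons a l ih => simp [ih]
  refine congr (foldl (b := fun _ => []) (f := fun _ b a => b ++ a) hl (const _) (by fun_prop)
    P fun s l' h => ?_) fun s => by rw [key, List.nil_append]
  rw [key, List.nil_append]
  exact (esize_flatten_le l').trans ((esize_le_of_sublist h.sublist).trans (hP s))

/-- Induction on the fixed number `K` by the hockey-stick identity: the fold sums the binomial
coefficients for `K`, and the list already read is its unary counter. -/
lemma choose (K : ℕ) {l : σ → List Unit} (hl : PT l) :
    PT fun s => ((l s).length + K).choose K := by
  suffices h : PT fun l : List Unit => (l.length + K).choose K from h.comp hl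
  clear hl l
  induction K with
  | zero => simpa using const 1
  | succ K ih =>
    have key (l : List Unit) : l.foldl (fun (p : List Unit × ℕ) (a : Unit) =>
        (a :: p.1, p.2 + ((a :: p.1).length + K).choose K)) ([], 1) =
        (l.reverse, (l.length + (K + 1)).choose (K + 1)) := by
      induction l using List.reverseRecOn with
      | nil => simp
      | append_singleton l b ih =>
        rw [List.foldl_append, ih]
        simp only [List.foldl_cons, List.foldl_nil, List.length_cons, List.length_reverse,
          List.reverse_append, List.reverse_singleton, List.singleton_append, List.length_append,
          List.length_nil, Nat.zero_add]
        rw [show l.length + 1 + (K + 1) = (l.length + 1 + K) + 1 by ring, Nat.choose_succ_succ,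
          show l.length + (K + 1) = l.length + 1 + K by ring, add_comm]
    refine congr (snd (foldl (l := fun l : List Unit => l) (b := fun _ => ([], 1))
      (f := fun _ p a => (a :: p.1, p.2 + ((a :: p.1).length + K).choose K)) id' (const _)
      (mk (by fun_prop) (add (by fun_prop) (ih.comp (by fun_prop))))
      (5 * X + 4 * ((K + 2 : ℕ) : ℕ[X]) + 2)
      fun s l' h => ?_)) fun s => by rw [key]
    rw [key, esize_prod, esize_reverse]
    have h1 := esize_le_of_sublist h.sublist
    have h2 := length_le_esize l'
    have h3 : (l'.length + (K + 1)).choose (K + 1) < 2 ^ (l'.length + (K + 2)) :=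
      (Nat.choose_le_two_pow _ _).trans_lt (Nat.pow_lt_pow_right one_lt_two (by omega))
    have h4 := esize_nat_le_of_lt h3
    simp only [eval_add, eval_mul, eval_ofNat, eval_X, eval_natCast, Nat.cast_id]
    omega

/-- The first list is read while the second is consumed, with a flag for agreement so far; the lists
are equal if the flag survives and nothing is left of the second. -/
lemma list_eq [DecidableEq α] (h : PT fun p : α × α => decide (p.1 = p.2)) :
    PT fun p : List α × List α => decide (p.1 = p.2) := by
  set f : List α × Bool → α → List α × Bool := fun s a => (s.1.tail, s.2 &&
    s.1.casesOn (motive := fun _ => Bool) false fun b _ => decide (a = b)) with hf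
  have key (l : List α) (s : List α × Bool) :
      ((l.foldl f s).2 && (l.foldl f s).1.isEmpty) = (s.2 && decide (l = s.1)) := by
    induction l generalizing s with
    | nil => obtain ⟨_ | ⟨b, m⟩, c⟩ := s <;> simp
    | cons a l ih =>
      rw [List.foldl_cons, ih]
      obtain ⟨_ | ⟨b, m⟩, c⟩ := s <;> simp [hf, Bool.and_assoc]
  have hlen (l : List α) (s : List α × Bool) : (l.foldl f s).1 = s.1.drop l.length := by
    induction l generalizing s with
    | nil => rfl
    | cons a l ih => rw [List.foldl_cons, ih]; simp [hf]
  have hfold : PT fun p : List α × List α => p.1.foldl f (p.2, true) := by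
    refine foldl (f := fun _ => f) (b := fun p : List α × List α => (p.2, true)) (by fun_prop)
      (by fun_prop) (mk (by fun_prop) (and (by fun_prop) (listCases
        (l := fun p : (List α × List α) × (List α × Bool) × α => p.2.1.1) (by fun_prop) (const _)
        (h.comp (f := fun q : ((List α × List α) × (List α × Bool) × α) × α × List α =>
          (q.1.2.2, q.2.1)) (by fun_prop))))) (X + 4) fun s l' _ => ?_
    have h1 := esize_le_of_sublist (List.drop_sublist l'.length s.2)
    have h2 := esize_bool_le (l'.foldl f (s.2, true)).2
    have h3 : esize (l'.foldl f (s.2, true)) = esize (l'.foldl f (s.2, true)).1 +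
      esize (l'.foldl f (s.2, true)).2 + 1 := rfl
    have h4 : esize s = esize s.1 + esize s.2 + 1 := rfl
    rw [hlen] at h3
    dsimp only at h3
    simp only [eval_add, eval_X, eval_ofNat]
    omega
  exact congr (and hfold.snd hfold.fst.isEmpty) fun p => by rw [key, Bool.true_and]

lemma mem [DecidableEq α] (h : PT fun p : α × α => decide (p.1 = p.2)) {a : σ → α}
    {l : σ → List α} (ha : PT a) (hl : PT l) : PT fun s => decide (a s ∈ l s) := by
  refine congr (not (isEmpty (filter (f := fun s b => decide (b = a s)) hl
    (h.comp (f := fun p : σ × α => (p.2, a p.1)) (by fun_prop))))) fun s => ?_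
  rw [Bool.eq_iff_iff]
  simp

end PT

end AEC

/-! ### The algorithms on lists of terms. -/

namespace AEC

open Enc MvPolynomial

/-- Terms, as a coefficient with a list of exponents in unary. -/
abbrev TermList : Type := List (ℤ × List (List Unit))

section Algorithms

/-- The largest value of `choose (d + K) K`, where `d` is the degree of a term. -/
def termsAlg (K : ℕ) (a : TermList × TermList) : ℕ :=
  ((a.1 ++ a.2).map fun t => (t.2.flatten.length + K).choose K).foldr max 0

/-- The largest absolute value of a coefficient. -/
def maxcAlg (a : TermList × TermList) : ℕ :=
  ((a.1 ++ a.2).map fun t => t.1.natAbs).foldr max 0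

/-- The bound, computed from a presentation of an instance. -/
def boundAlg (K : ℕ) (x : List (TermList × TermList) × (TermList × TermList) × Data) : ℕ :=
  2 * termsAlg K x.2.1 * maxcAlg x.2.1 *
    (2 * (x.1.map (termsAlg K)).sum * (x.1.map maxcAlg).foldr max 0) ^ x.1.length

/-- The distinct elements of a list. -/
def distinct {α : Type} [DecidableEq α] (l : List α) : List α :=
  l.foldl (fun acc a => bif decide (a ∈ acc) then acc else a :: acc) []

/-- The coefficient of the terms with exponents `p`, after the substitution of `B` for the last
variable. -/
def coeffAlg (B : ℕ) (l : TermList) (p : List (List Unit)) : ℤ :=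
  ((l.filter fun t => decide (t.2.reverse.tail = p)).map fun t =>
    t.1 * ((B ^ t.2.reverse.headI.length : ℕ) : ℤ)).sum

/-- Substitution of `B` for the last variable; the remaining exponents are kept in reverse order. -/
def substAlg (B : ℕ) (l : TermList) : TermList :=
  (((distinct (l.map fun t => t.2.reverse.tail)).map fun p => (coeffAlg B l p, p)).filter
    fun t => !decide (t.1 = 0)).map fun t => (t.1, t.2.reverse)

/-- Substitution in an instance. -/
def instAlg (x : (List (TermList × TermList) × (TermList × TermList) × Data) × ℕ) :
    List (TermList × TermList) × (TermList × TermList) × Data :=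
  (x.1.1.map fun a => (substAlg x.2 a.1, substAlg x.2 a.2),
    (substAlg x.2 x.1.2.1.1, substAlg x.2 x.1.2.1.2), x.1.2.2)

lemma distinct_spec {α : Type} [DecidableEq α] (l : List α) :
    (distinct l).Nodup ∧ ∀ a, a ∈ distinct l ↔ a ∈ l := by
  induction l using List.reverseRecOn with
  | nil => simp [distinct]
  | append_singleton l b ih =>
    have h : distinct (l ++ [b]) =
        bif decide (b ∈ distinct l) then distinct l else b :: distinct l := by
      rw [distinct, List.foldl_append]
      rfl
    rw [h]
    by_cases hb : b ∈ distinct l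
    · have := (ih.2 b).1 hb
      simp only [hb, decide_true, cond_true]
      refine ⟨ih.1, fun a => ?_⟩
      rw [ih.2, List.mem_append, List.mem_singleton]
      exact ⟨Or.inl, by rintro (h | rfl) <;> assumption⟩
    · simp only [hb, decide_false, cond_false]
      refine ⟨List.nodup_cons.2 ⟨hb, ih.1⟩, fun a => ?_⟩
      rw [List.mem_cons, ih.2, List.mem_append, List.mem_singleton, or_comm]

namespace PT

variable {σ α : Type} [Enc σ] [Enc α]

lemma termsAlg (K : ℕ) : PT (termsAlg K) :=
  foldr_max (map (l := fun a : TermList × TermList => a.1 ++ a.2) (by fun_prop)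
    (choose K (by fun_prop)))

lemma maxcAlg : PT maxcAlg :=
  foldr_max (map (l := fun a : TermList × TermList => a.1 ++ a.2) (by fun_prop) (by fun_prop))

lemma boundAlg (K : ℕ) : PT (boundAlg K) := by
  have h1 := termsAlg K
  have h2 := maxcAlg
  have h3 : PT fun x : List (TermList × TermList) × (TermList × TermList) × Data =>
    x.1.map (AEC.termsAlg K) := map (by fun_prop) (h1.comp (by fun_prop))
  have h4 : PT fun x : List (TermList × TermList) × (TermList × TermList) × Data =>
    x.1.map AEC.maxcAlg := map (by fun_prop) (h2.comp (by fun_prop))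
  unfold AEC.boundAlg
  fun_prop

lemma distinct [DecidableEq α] (h : PT fun p : α × α => decide (p.1 = p.2)) :
    PT (distinct (α := α)) := by
  refine foldl (l := fun l : List α => l) (b := fun _ => [])
    (f := fun _ acc a => bif decide (a ∈ acc) then acc else a :: acc) id' (const _)
    (cond (mem h (by fun_prop) (by fun_prop)) (by fun_prop) (by fun_prop)) Polynomial.X
    fun l l' hl => ?_
  rw [Polynomial.eval_X]
  -- The accumulator is never larger than the part of the list already read.
  refine le_trans ?_ (esize_le_of_sublist hl.sublist)
  clear hl
  induction l' using List.reverseRecOn with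
  | nil => exact le_rfl
  | append_singleton l' b ih =>
    rw [List.foldl_append, List.foldl_cons, List.foldl_nil]
    have hb : esize (l' ++ [b]) = esize b + esize l' + 1 := by
      simp [esize_list]; omega
    rw [hb]
    cases decide (b ∈ List.foldl (fun acc a => bif decide (a ∈ acc) then acc else a :: acc) [] l')
    · rw [cond_false, esize_cons]; omega
    · rw [cond_true]; omega

lemma coeffAlg : PT fun x : (ℕ × TermList) × List (List Unit) => coeffAlg x.1.1 x.1.2 x.2 := by
  have h : PT fun p : List (List Unit) × List (List Unit) => decide (p.1 = p.2) :=
    -- Equality on `Unit` is constantly true; it is lifted to unary numbers and then to exponent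
    -- lists.
    list_eq (list_eq (congr (const true) fun _ => by simp))
  refine int_sum (map (filter (f := fun (x : (ℕ × TermList) × List (List Unit))
    (t : ℤ × List (List Unit)) => decide (t.2.reverse.tail = x.2)) (by fun_prop)
    (h.comp (f := fun p : ((ℕ × TermList) × List (List Unit)) × ℤ × List (List Unit) =>
      (p.2.2.reverse.tail, p.1.2)) (by fun_prop))) (by fun_prop))

lemma substAlg : PT fun x : ℕ × TermList => substAlg x.1 x.2 := by
  have h : PT fun p : List (List Unit) × List (List Unit) => decide (p.1 = p.2) :=
    list_eq (list_eq (congr (const true) fun _ => by simp))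
  refine map (filter (map ((distinct h).comp (map (by fun_prop) (by fun_prop)))
    (mk coeffAlg (by fun_prop))) (by fun_prop)) (by fun_prop)

lemma instAlg : PT instAlg := by
  have h := substAlg
  refine mk (map (by fun_prop) (mk (h.comp (f := fun p : ((List (TermList × TermList) ×
    (TermList × TermList) × Data) × ℕ) × TermList × TermList => (p.1.2, p.2.1)) (by fun_prop))
    (h.comp (f := fun p : ((List (TermList × TermList) ×
    (TermList × TermList) × Data) × ℕ) × TermList × TermList => (p.1.2, p.2.2)) (by fun_prop))))
    (mk (mk (h.comp (f := fun p : (List (TermList × TermList) ×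
    (TermList × TermList) × Data) × ℕ => (p.2, p.1.2.1.1)) (by fun_prop))
    (h.comp (f := fun p : (List (TermList × TermList) ×
    (TermList × TermList) × Data) × ℕ => (p.2, p.1.2.1.2)) (by fun_prop))) (by fun_prop))

end PT

end Algorithms

/-! ### Correctness of the algorithms for every presentation. -/

section Correctness

variable {k : ℕ}

/-- The exponents in unary. -/
def expList (e : Fin k →₀ ℕ) : List (List Unit) := List.ofFn fun i => List.replicate (e i) ()

lemma enc_replicate (n : ℕ) : enc (List.replicate n ()) = Data.ofUnary n := by
  simp [enc, Data.ofUnary]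

lemma enc_term (c : ℤ) (e : Fin k →₀ ℕ) : enc (c, expList e) = termData c e := by
  rw [enc_prod, termData]
  congr 1
  simp only [expList, enc, List.map_ofFn]
  congr 2
  funext i
  exact enc_replicate _

lemma expList_injective : Function.Injective (expList (k := k)) := by
  intro e e' h
  ext i
  have := congrFun (List.ofFn_injective h) i
  simpa using congrArg List.length this

/-- The algorithms reverse the exponent lists because this puts the substituted variable at the
head. -/
lemma expList_reverse_succ (e : Fin (k + 1) →₀ ℕ) : (expList e).reverse =
    List.replicate (e (Fin.last k)) () :: (expList (initExp e)).reverse := by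
  rw [expList, List.ofFn_succ_last, List.reverse_append]
  rfl

lemma length_flatten_expList (e : Fin k →₀ ℕ) : (expList e).flatten.length = e.degree := by
  simp [expList, Finsupp.degree_eq_sum, List.length_flatten, List.map_ofFn, Function.comp_def,
    List.sum_ofFn]

/-- `l` lists the nonzero terms of `f`. -/
def ListsTerms (f : MvPolynomial (Fin k) ℤ) (l : TermList) : Prop :=
  ∃ s : List (Fin k →₀ ℕ), s.Nodup ∧ (∀ e, e ∈ s ↔ e ∈ f.support) ∧
    l = s.map fun e => (f.coeff e, expList e)

lemma polyRep_iff {f : MvPolynomial (Fin k) ℤ} {d : Data} :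
    PolyRep f d ↔ ∃ l, ListsTerms f l ∧ d = enc l := by
  have h (s : List (Fin k →₀ ℕ)) : enc (s.map fun e => (f.coeff e, expList e)) =
      Data.ofList (s.map fun e => termData (f.coeff e) e) := by
    change Data.ofList ((s.map _).map enc) = _
    rw [List.map_map]
    exact congrArg _ (List.map_congr_left fun e _ => enc_term _ _)
  constructor
  · rintro ⟨s, h1, h2, rfl⟩
    exact ⟨_, ⟨s, h1, h2, rfl⟩, (h s).symm⟩
  · rintro ⟨_, ⟨s, h1, h2, rfl⟩, rfl⟩
    exact ⟨s, h1, h2, h s⟩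

lemma ListsTerms.coeffAlg_eq {f : MvPolynomial (Fin (k + 1)) ℤ} {l : TermList}
    (h : ListsTerms f l) (B : ℕ) (e : Fin k →₀ ℕ) :
    coeffAlg B l (expList e).reverse = (substPoly B f).coeff e := by
  classical
  obtain ⟨s, h1, h2, rfl⟩ := h
  have hs : f.support = s.toFinset := by ext e; simp [h2]
  rw [coeff_substPoly, hs, List.sum_toFinset _ h1, coeffAlg]
  -- The remaining identity holds term by term, for an arbitrary list `s`.
  clear hs h2 h1
  induction s with
  | nil => rfl
  | cons a s ih =>
    rw [List.map_cons, List.map_cons, List.sum_cons, ← ih]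
    have ha : (expList a).reverse.tail = (expList e).reverse ↔ initExp a = e := by
      rw [expList_reverse_succ, List.tail_cons, List.reverse_inj, expList_injective.eq_iff]
    by_cases h : initExp a = e
    · rw [List.filter_cons_of_pos (by simpa only [decide_eq_true_iff, ha] using h), if_pos h,
        List.map_cons, List.sum_cons, expList_reverse_succ]
      simp
    · rw [List.filter_cons_of_neg (by simpa only [decide_eq_true_iff, ha] using h), if_neg h,
        zero_add]

/-- Terms that differ only in the last exponent are merged and may cancel. Hence the candidates are
the distinct truncated exponent lists, and those with coefficient zero are removed. -/
lemma ListsTerms.substAlg {f : MvPolynomial (Fin (k + 1)) ℤ} {l : TermList}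
    (h : ListsTerms f l) (B : ℕ) : ListsTerms (substPoly B f) (substAlg B l) := by
  classical
  obtain ⟨s, h1, h2, hl⟩ := id h
  obtain ⟨hd1, hd2⟩ := distinct_spec (l.map fun t => t.2.reverse.tail)
  have hmap : l.map (fun t => t.2.reverse.tail) = s.map fun e => (expList (initExp e)).reverse := by
    rw [hl, List.map_map]
    exact List.map_congr_left fun e _ => by
      simp only [Function.comp_apply, expList_reverse_succ, List.tail_cons]
  -- All candidates come from genuine exponent vectors; `u` lists these.
  obtain ⟨u, hu⟩ : ∃ u : List (Fin k →₀ ℕ), u.map (fun e => (expList e).reverse) =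
      distinct (l.map fun t => t.2.reverse.tail) := by
    rw [← Set.mem_range, Set.range_list_map]
    intro p hp
    rw [hd2, hmap] at hp
    obtain ⟨e, -, rfl⟩ := List.mem_map.1 hp
    exact ⟨_, rfl⟩
  have hinj : Function.Injective fun e : Fin k →₀ ℕ => (expList e).reverse :=
    List.reverse_injective.comp expList_injective
  refine ⟨u.filter fun e => !decide ((substPoly B f).coeff e = 0), ?_, fun e => ?_, ?_⟩
  · rw [← hu] at hd1
    exact (hd1.of_map _).filter _
  · simp only [List.mem_filter, mem_support_iff, Bool.not_eq_true', decide_eq_false_iff_not,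
      and_iff_right_iff_imp]
    intro he
    have hmem : (expList e).reverse ∈ distinct (l.map fun t => t.2.reverse.tail) := by
      rw [hd2, hmap]
      rw [coeff_substPoly] at he
      obtain ⟨e', he', hne⟩ := Finset.exists_ne_zero_of_sum_ne_zero he
      refine List.mem_map.2 ⟨e', (h2 e').2 he', ?_⟩
      rw [show initExp e' = e by by_contra h; simp [h] at hne]
    rw [← hu] at hmem
    exact (List.mem_map_of_injective hinj).1 hmem
  · rw [AEC.substAlg, ← hu, List.map_map, List.filter_map, List.map_map]
    simp only [Function.comp_def, h.coeffAlg_eq, List.reverse_reverse]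

lemma ListsTerms.mem_iff {f : MvPolynomial (Fin k) ℤ} {l : TermList} (h : ListsTerms f l)
    (t : ℤ × List (List Unit)) : t ∈ l ↔ ∃ e ∈ f.support, (f.coeff e, expList e) = t := by
  obtain ⟨s, -, h2, rfl⟩ := h
  simp [h2]

lemma exists_degree_eq_totalDegree {f : MvPolynomial (Fin k) ℤ} (h : f ≠ 0) :
    ∃ e ∈ f.support, e.degree = f.totalDegree := by
  obtain ⟨e, he, h⟩ := Finset.exists_mem_eq_sup f.support (support_nonempty.2 h)
    fun e => e.sum fun _ n => n
  exact ⟨e, he, by rw [totalDegree, h]; simp [Finsupp.degree_eq_sum, Finsupp.sum_fintype]⟩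

/-- The lists of the nonzero terms of the numerator and of the denominator. -/
def ListsFrac (a : Frac k) (x : TermList × TermList) : Prop :=
  ListsTerms a.num x.1 ∧ ListsTerms a.den x.2

lemma fracRep_iff {a : Frac k} {d : Data} : FracRep a d ↔ ∃ x, ListsFrac a x ∧ d = enc x := by
  simp only [FracRep, polyRep_iff]
  constructor
  · rintro ⟨_, _, ⟨l, hl, rfl⟩, ⟨m, hm, rfl⟩, rfl⟩
    exact ⟨(l, m), ⟨hl, hm⟩, rfl⟩
  · rintro ⟨⟨l, m⟩, ⟨hl, hm⟩, rfl⟩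
    exact ⟨_, _, ⟨l, hl, rfl⟩, ⟨m, hm, rfl⟩, rfl⟩

/-- The binomial coefficient is monotone in the degree, so its maximum over the terms is attained at
a term of top degree. A nonzero denominator guarantees that there is a term; without any, the
maximum would be `0` instead of `1`. -/
lemma ListsFrac.termsAlg_eq {a : Frac k} {x : TermList × TermList} (h : ListsFrac a x)
    (ha : a.den ≠ 0) : termsAlg k x = a.terms := by
  have hsymm : a.terms = (a.deg + k).choose k := by
    rw [Frac.terms, ← Nat.choose_symm_of_eq_add rfl]
  rw [hsymm]
  refine le_antisymm (foldr_max_map_le fun t ht => ?_) ?_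
  · refine Nat.choose_le_choose k (Nat.add_le_add_right ?_ k)
    rcases List.mem_append.1 ht with ht | ht
    · obtain ⟨e, he, rfl⟩ := (h.1.mem_iff t).1 ht
      rw [length_flatten_expList]
      exact (degree_le_totalDegree he).trans (le_max_left _ _)
    · obtain ⟨e, he, rfl⟩ := (h.2.mem_iff t).1 ht
      rw [length_flatten_expList]
      exact (degree_le_totalDegree he).trans (le_max_right _ _)
  · obtain ⟨t, ht, htd⟩ : ∃ t ∈ x.1 ++ x.2, t.2.flatten.length = a.deg := by
      obtain ⟨e, he, hed⟩ := exists_degree_eq_totalDegree ha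
      rcases le_total a.num.totalDegree a.den.totalDegree with hle | hle
      · refine ⟨_, List.mem_append_right _ ((h.2.mem_iff _).2 ⟨e, he, rfl⟩), ?_⟩
        rw [length_flatten_expList, hed, Frac.deg, max_eq_right hle]
      -- A zero numerator has no terms; its total degree is `0`, so the denominator attains the
      -- maximum.
      · by_cases hn : a.num = 0
        · refine ⟨_, List.mem_append_right _ ((h.2.mem_iff _).2 ⟨e, he, rfl⟩), ?_⟩
          rw [length_flatten_expList, hed, Frac.deg, hn, totalDegree_zero, Nat.zero_max]
        · obtain ⟨e, he, hed⟩ := exists_degree_eq_totalDegree hn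
          refine ⟨_, List.mem_append_left _ ((h.1.mem_iff _).2 ⟨e, he, rfl⟩), ?_⟩
          rw [length_flatten_expList, hed, Frac.deg, max_eq_left hle]
    rw [← htd]
    exact le_foldr_max_map (g := fun t => (t.2.flatten.length + k).choose k) ht

lemma ListsFrac.maxcAlg_eq {a : Frac k} {x : TermList × TermList} (h : ListsFrac a x) :
    maxcAlg x = a.maxc := by
  refine le_antisymm (foldr_max_map_le fun t ht => ?_) (max_le (Finset.sup_le fun e he => ?_)
    (Finset.sup_le fun e he => ?_))
  · rcases List.mem_append.1 ht with ht | ht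
    · obtain ⟨e, he, rfl⟩ := (h.1.mem_iff t).1 ht
      exact (natAbs_coeff_le _ _).trans (le_max_left _ _)
    · obtain ⟨e, he, rfl⟩ := (h.2.mem_iff t).1 ht
      exact (natAbs_coeff_le _ _).trans (le_max_right _ _)
  · exact le_foldr_max_map (g := fun t : ℤ × List (List Unit) => t.1.natAbs)
      (List.mem_append_left _ ((h.1.mem_iff _).2 ⟨e, he, rfl⟩))
  · exact le_foldr_max_map (g := fun t : ℤ × List (List Unit) => t.1.natAbs)
      (List.mem_append_right _ ((h.2.mem_iff _).2 ⟨e, he, rfl⟩))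

variable {ops : Set Op} {var : Variant}

/-- The lists of the terms in an instance. -/
def ListsInstance (I : Instance ops var (Frac k))
    (x : List (TermList × TermList) × (TermList × TermList) × Data) : Prop :=
  List.Forall₂ ListsFrac I.values x.1 ∧ ListsFrac I.target x.2.1 ∧
    x.2.2 = Extra.data ops var I.extra

lemma listRep_iff {l : List (Frac k)} {d : Data} :
    ListRep FracRep l d ↔ ∃ x, List.Forall₂ ListsFrac l x ∧ d = enc x := by
  constructor
  · rintro ⟨ds, h, rfl⟩
    induction h with
    | nil => exact ⟨[], .nil, rfl⟩
    | cons h _ ih =>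
      obtain ⟨x, hx, hxd⟩ := ih
      obtain ⟨y, hy, rfl⟩ := fracRep_iff.1 h
      exact ⟨y :: x, .cons hy hx, by rw [Data.ofList, hxd, enc_cons]⟩
  · rintro ⟨x, h, rfl⟩
    refine ⟨x.map enc, ?_, rfl⟩
    rw [List.forall₂_map_right_iff]
    exact h.imp fun _ _ h => fracRep_iff.2 ⟨_, h, rfl⟩

lemma instanceRep_iff {I : Instance ops var (Frac k)} {d : Data} :
    InstanceRep I d ↔ ∃ x, ListsInstance I x ∧ d = enc x := by
  simp only [InstanceRep, listRep_iff, fracRep_iff]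
  constructor
  · rintro ⟨_, _, ⟨l, hl, rfl⟩, ⟨m, hm, rfl⟩, rfl⟩
    exact ⟨(l, m, _), ⟨hl, hm, rfl⟩, rfl⟩
  · rintro ⟨⟨l, m, _⟩, ⟨hl, hm, rfl⟩, rfl⟩
    exact ⟨_, _, ⟨l, hl, rfl⟩, ⟨m, hm, rfl⟩, rfl⟩

lemma ListsInstance.instAlg {I : Instance ops var (Frac (k + 1))}
    {x : List (TermList × TermList) × (TermList × TermList) × Data} (h : ListsInstance I x)
    (B : ℕ) : ListsInstance (I.map (Frac.subst B)) (instAlg (x, B)) := by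
  obtain ⟨h1, h2, h3⟩ := h
  refine ⟨?_, ⟨h2.1.substAlg B, h2.2.substAlg B⟩, h3⟩
  change List.Forall₂ _ (I.values.map _) (x.1.map _)
  rw [List.forall₂_map_left_iff, List.forall₂_map_right_iff]
  exact h1.imp fun _ _ h => ⟨h.1.substAlg B, h.2.substAlg B⟩

lemma ListsInstance.boundAlg_eq {I : RatInstance ops var k}
    {x : List (TermList × TermList) × (TermList × TermList) × Data}
    (h : ListsInstance I.inst x) : boundAlg k x = I.bound := by
  obtain ⟨h1, h2, -⟩ := h
  have hv := I.values_den
  have key {l : List (Frac k)} {m : List (TermList × TermList)} (h : List.Forall₂ ListsFrac l m)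
      (hl : ∀ a ∈ l, a.den ≠ 0) : m.map (termsAlg k) = l.map Frac.terms ∧
        m.map maxcAlg = l.map Frac.maxc ∧ m.length = l.length := by
    induction h with
    | nil => simp
    | cons h _ ih =>
      obtain ⟨e1, e2, e3⟩ := ih fun a ha => hl a (by simp [ha])
      simp [e1, e2, e3, h.termsAlg_eq (hl _ (by simp)), h.maxcAlg_eq]
  obtain ⟨e1, e2, e3⟩ := key h1 hv
  rw [boundAlg, RatInstance.bound, e1, e2, e3, h2.termsAlg_eq I.target_den, h2.maxcAlg_eq]

lemma polyTime_bound : PolyTime RatInstance.Rep NatRep (RatInstance.bound (ops := ops) (var := var)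
    (k := k)) := by
  obtain ⟨p, T, h⟩ := PT.boundAlg k
  refine ⟨p, T, fun I d hd => ?_⟩
  obtain ⟨x, hx, rfl⟩ := instanceRep_iff.1 hd
  obtain ⟨c, hc, hT⟩ := h x
  exact ⟨_, c, hc, hT, by rw [hx.boundAlg_eq]; rfl⟩

/-- The result is only an `Instance`, because for small `B` a denominator may vanish. -/
lemma polyTime_subst : PolyTime (ProdRep RatInstance.Rep NatRep) InstanceRep
    (fun x : RatInstance ops var (k + 1) × ℕ => x.1.inst.map (Frac.subst x.2)) := by
  obtain ⟨p, T, h⟩ := PT.instAlg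
  refine ⟨p, T, fun ⟨I, B⟩ d hd => ?_⟩
  obtain ⟨_, _, h1, rfl, rfl⟩ := hd
  obtain ⟨x, hx, rfl⟩ := instanceRep_iff.1 h1
  obtain ⟨c, hc, hT⟩ := h (x, B)
  exact ⟨_, c, hc, hT, instanceRep_iff.2 ⟨_, hx.instAlg B, rfl⟩⟩

end Correctness

/-- Apply a polynomial-time function of a pair to `(a, g a)`. -/
lemma PolyTime.comp_pair {α β γ : Type} {ρ : α → Data → Prop} {σ : β → Data → Prop}
    {τ : γ → Data → Prop} {f : α × β → γ} {g : α → β} (hf : PolyTime (ProdRep ρ σ) τ f)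
    (hg : PolyTime ρ σ g) : PolyTime ρ τ fun a => f (a, g a) := by
  obtain ⟨p, T, hp⟩ := hf
  obtain ⟨q, U, hq⟩ := hg
  have key (a : α) (d : Data) (h : ρ a d) :=
    let ⟨d₁, c, h1, h2, h3⟩ := hq a d h
    let ⟨d₂, c', h4, h5, h6⟩ := hp (a, g a) (Data.cons d d₁) ⟨d, d₁, h, h3, rfl⟩
    show ∃ d₂, Computes _ _ d d₂ ∧ τ (f (a, g a)) d₂ from
      ⟨d₂, ((Computes.id d).pair ⟨c, h1, h2⟩).seq ⟨c', h4, h5⟩, h6⟩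
  exact ⟨_, _, fun a d h =>
    let ⟨d₂, ⟨c, h1, h2⟩, h3⟩ := key a d h
    ⟨d₂, c, h1, h2, h3⟩⟩

end AEC

theorem theorem1 (ops : Set Op) (var : Variant) (k : ℕ) :
    ∃ A : RatInstance ops var (k + 1) → ℕ,
      -- `A` maps instances to positive integers, is given by the explicit bound, and is efficient
      (∀ I, 0 < A I) ∧
      (∀ I, A I = I.bound) ∧
      PolyTime RatInstance.Rep NatRep A ∧
      -- substituting any `B ≥ A I` gives an instance with one variable less and the same answer
      (∀ (I : RatInstance ops var (k + 1)) (B : ℕ), A I ≤ B →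
        ∃ J : RatInstance ops var k, I.IsSubst B J ∧ (I.Solvable ↔ J.Solvable)) ∧
      -- the substitution takes polynomial time in the length of the instance and of `B`
      PolyTime (ProdRep RatInstance.Rep NatRep) InstanceRep
        (fun x : RatInstance ops var (k + 1) × ℕ => x.1.inst.map (Frac.subst x.2)) ∧
      -- hence it is a polynomial-time reduction for every efficiently chosen `B ≥ A I`
      (∀ B : RatInstance ops var (k + 1) → ℕ, PolyTime RatInstance.Rep NatRep B →
        (∀ I, A I ≤ B I) →
        ∃ R : RatInstance ops var (k + 1) → RatInstance ops var k,
          (∀ I : RatInstance ops var (k + 1), I.IsSubst (B I) (R I)) ∧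
          IsPolyTimeReduction RatInstance.Rep RatInstance.Rep
            RatInstance.Solvable RatInstance.Solvable R) := by
  refine ⟨RatInstance.bound, RatInstance.bound_pos, fun _ => rfl, polyTime_bound,
    fun I B hB => I.exists_isSubst hB, polyTime_subst, fun B hB hle => ?_⟩
  choose R hR hsolv using fun I => RatInstance.exists_isSubst I (hle I)
  refine ⟨R, hR, ?_, hsolv⟩
  obtain ⟨p, T, h⟩ := polyTime_subst.comp_pair hB
  refine ⟨p, T, fun I d hd => ?_⟩
  obtain ⟨d', c, h1, h2, h3⟩ := h I d hd
  refine ⟨d', c, h1, h2, ?_⟩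
  -- A presentation depends only on the underlying `inst`, so the program for the substitution also
  -- computes the chosen `R`.
  rw [RatInstance.Rep, hR I]
  exact h3
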